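/- **Setting.** Let $\Omega>0$, $\Omega\neq 1$, $C=\frac{(1-\Omega)^2}{4\Omega}$, $\theta>0$, $\mu\in\mathbb R$, and $\tilde\Omega=\frac{2\Omega}{\theta}$. Let $\gamma^0,\gamma^1$ be skew-Hermitian $2\times2$ complex matrices with $\gamma^\mu\gamma^\nu+\gamma^\nu\gamma^\mu=-2\delta^{\mu\nu}\mathbb 1_2$. For $0<\alpha<1$ and $m,n,k,l\in\mathbb N$ let $\Gamma^\alpha_{m,n;k,l}=0$ unless $n-m=k-l$, and in that case, with $h=n-m=k-l\in\mathbb Z$ (so $n=m+h$, $k=l+h$), $$\Gamma^\alpha_{m,m+h;l+h,l}=\Big(\tfrac{\sqrt{1-\alpha}}{1+C\alpha}\Big)^{m+l+h}(1-\alpha)^{-h/2}\sum_{u=\max(0,-h)}^{\min(m,l)}\frac{\sqrt{m!\,(m+h)!\,l!\,(l+h)!}}{(m-u)!\,(l-u)!\,(h+u)!\,u!}\Big(\tfrac{C\alpha(1+\Omega)}{\sqrt{1-\alpha}\,(1-\Omega)}\Big)^{m+l-2u}.$$ For an array $\Gamma=(\Gamma_{m,n;k,l})$ put (terms with a negative index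 have coefficient $0$) $$[x^0,\Gamma]_{m,n;k,l}=2\pi\theta\sqrt{\tfrac{\theta}{8}}\Big\{\sqrt{m+1}\,\Gamma_{m+1,n;k,l}-\sqrt l\,\Gamma_{m,n;k,l-1}+\sqrt m\,\Gamma_{m-1,n;k,l}-\sqrt{l+1}\,\Gamma_{m,n;k,l+1}+\sqrt{n+1}\,\Gamma_{m,n+1;k,l}-\sqrt k\,\Gamma_{m,n;k-1,l}+\sqrt n\,\Gamma_{m,n-1;k,l}-\sqrt{k+1}\,\Gamma_{m,n;k+1,l}\Big\},$$ $$[x^1,\Gamma]_{m,n;k,l}=2i\pi\theta\sqrt{\tfrac{\theta}{8}}\Big\{\sqrt{m+1}\,\Gamma_{m+1,n;k,l}-\sqrt l\,\Gamma_{m,n;k,l-1}-\sqrt m\,\Gamma_{m-1,n;k,l}+\sqrt{l+1}\,\Gamma_{m,n;k,l+1}-\sqrt{n+1}\,\Gamma_{m,n+1;k,l}+\sqrt k\,\Gamma_{m,n;k-1,l}+\sqrt n\,\Gamma_{m,n-1;k,l}-\sqrt{k+1}\,\Gamma_{m,n;k+1,l}\Big\},$$ $[\slashed x,\Gamma]=\gamma^0[x^0,\Gamma]+\gamma^1[x^1,\Gamma]$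 and $[\slashed{\tilde x},\Gamma]=\frac2\theta\big(-\gamma^0[x^1,\Gamma]+\gamma^1[x^0,\Gamma]\big)$. With $S_\alpha=\frac{2-\alpha}{2\sqrt{1-\alpha}}\mathbb 1_2-i\frac{\alpha}{2\sqrt{1-\alpha}}\gamma^0\gamma^1$ define $$G^{\alpha,\mathrm{comm}}_{m,n;k,l}=\Big(i\tilde\Omega\tfrac{2-\alpha}{\alpha}[\slashed x,\Gamma^\alpha]_{m,n;k,l}+\Omega[\slashed{\tilde x},\Gamma^\alpha]_{m,n;k,l}\Big)S_\alpha,\qquad G^{\alpha,\mathrm{mass}}_{m,n;k,l}=-\mu\,\Gamma^\alpha_{m,n;k,l}\,S_\alpha .$$ For a real $M>1$ and an integer $i\ge1$ the commutator part ($\bullet=\mathrm{comm}$) and the mass part ($\bullet=\mathrm{mass}$) of the matrix-basis propagator of the vulcanized noncommutative Gross–Neveu model in the slice $i$ are the $2\times2$ matrices $$G^{i,\bullet}_{m,n;k,l}=-\frac{2\Omega}{\theta^2\pi^2}\int_{M^{-i}}^{M^{-i+1}}d\alpha\;G^{\alpha,\bullet}_{m,n;k,l}.$$ **Theorem (Propagators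 for NCQFT).** For every $\Omega>0$ with $\Omega\ne1$ and every $M>1$ there are constants $K>0$ and $c>0$, depending only on $\Omega$ and $M$, such that for all $\gamma^0,\gamma^1$ as above, all $\theta>0$, $\mu\in\mathbb R$, all integers $i\ge1$ and all $m,n,k,l\in\mathbb N$ with $h=n-m\ge0$ and $p=l-m\ge0$ the integrals above converge absolutely and, with $|\cdot|$ the largest absolute value of a matrix entry, $$|G^{i,\mathrm{comm}}_{m,n;k,l}|\le K\,\theta^{-3/2}\,M^{-i/2}\left(\frac{\exp\Big\{-\frac{c\,p^2}{1+kM^{-i}}-\frac{c\,M^{-i}}{1+k}\big(h-\frac{k}{1+C}\big)^2\Big\}}{1+\sqrt{kM^{-i}}}+e^{-c\,kM^{-i}-c\,p}\right),$$ $$|G^{i,\mathrm{mass}}_{m,n;k,l}|\le K\,|\mu|\,\theta^{-2}\,M^{-i}\left(\frac{\exp\Big\{-\frac{c\,p^2}{1+kM^{-i}}-\frac{c\,M^{-i}}{1+k}\big(h-\frac{k}{1+C}\big)^2\Big\}}{1+\sqrt{kM^{-i}}}+e^{-c\,kM^{-i}-c\,p}\right).$$ -/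

import Mathlib

open scoped Matrix Nat

noncomputable section

namespace NCGrossNeveu

/-- Two-dimensional Euclidean Dirac matrices with `{γ^μ, γ^ν} = -2 δ^{μν}`, skew-Hermitian
(so that `(p̸ + μ)(-p̸ + μ) = p² + μ²`). -/
structure IsDiracPair (γ0 γ1 : Matrix (Fin 2) (Fin 2) ℂ) : Prop where
  sq_zero : γ0 * γ0 = -1
  sq_one : γ1 * γ1 = -1
  anticomm : γ0 * γ1 + γ1 * γ0 = 0
  skew_zero : γ0ᴴ = -γ0
  skew_one : γ1ᴴ = -γ1

/-- `C = (1 - Ω)² / (4 Ω)`. -/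
def constC (Ω : ℝ) : ℝ := (1 - Ω) ^ 2 / (4 * Ω)

/-- The combinatorial factor `𝒜(m, l, h, u)` with `n = m + h`, `k = l + h`:
`√(m! (m+h)! l! (l+h)!) / ((m-u)! (l-u)! (h+u)! u!)`.
It is only used for `m - n ≤ u ≤ min m l`, where all subtractions are exact. -/
def combA (m n k l u : ℕ) : ℝ :=
  Real.sqrt ((m ! : ℝ) * (n ! : ℝ) * (l ! : ℝ) * (k ! : ℝ)) /
    (((m - u)! : ℝ) * ((l - u)! : ℝ) * ((n + u - m)! : ℝ) * (u ! : ℝ))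

/-- The matrix-basis kernel `Γ^α_{m,n;k,l}`. It vanishes unless `h := n - m = k - l`, and then it is
`(√(1-α)/(1+Cα))^{m+l+h} (1-α)^{-Bh/(2Ω)}
  ∑_{u = max(0,-h)}^{min(m,l)} 𝒜(m,l,h,u) (Cα(1+Ω)/(√(1-α)(1-Ω)))^{m+l-2u}`.
Here `m + l + h = n + l`, and `m - n` in the summation range is truncated subtraction,
that is, `max(0, -h)`. -/
def kernelΓ (Ω B α : ℝ) (m n k l : ℕ) : ℝ :=
  if n + l = k + m then
    (Real.sqrt (1 - α) / (1 + constC Ω * α)) ^ (n + l) *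
      (1 - α) ^ (-(B * ((n : ℝ) - (m : ℝ)) / (2 * Ω))) *
      ∑ u ∈ Finset.Icc (m - n) (min m l),
        combA m n k l u *
          (constC Ω * α * (1 + Ω) / (Real.sqrt (1 - α) * (1 - Ω))) ^ (m + l - 2 * u)
  else 0

/-- The matrix elements of the commutator `[x⁰, Γ]`. Terms in which an index would become `-1`
carry the coefficient `√0`. -/
def commX0 (θ : ℝ) (Γ : ℕ → ℕ → ℕ → ℕ → ℝ) (m n k l : ℕ) : ℂ :=
  ((2 * Real.pi * θ * Real.sqrt (θ / 8) : ℝ) : ℂ) *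
    ((Real.sqrt (m + 1) * Γ (m + 1) n k l - Real.sqrt l * Γ m n k (l - 1)
      + Real.sqrt m * Γ (m - 1) n k l - Real.sqrt (l + 1) * Γ m n k (l + 1)
      + Real.sqrt (n + 1) * Γ m (n + 1) k l - Real.sqrt k * Γ m n (k - 1) l
      + Real.sqrt n * Γ m (n - 1) k l - Real.sqrt (k + 1) * Γ m n (k + 1) l : ℝ) : ℂ)

/-- The matrix elements of the commutator `[x¹, Γ]`. -/
def commX1 (θ : ℝ) (Γ : ℕ → ℕ → ℕ → ℕ → ℝ) (m n k l : ℕ) : ℂ :=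
  Complex.I * ((2 * Real.pi * θ * Real.sqrt (θ / 8) : ℝ) : ℂ) *
    ((Real.sqrt (m + 1) * Γ (m + 1) n k l - Real.sqrt l * Γ m n k (l - 1)
      - Real.sqrt m * Γ (m - 1) n k l + Real.sqrt (l + 1) * Γ m n k (l + 1)
      - Real.sqrt (n + 1) * Γ m (n + 1) k l + Real.sqrt k * Γ m n (k - 1) l
      + Real.sqrt n * Γ m (n - 1) k l - Real.sqrt (k + 1) * Γ m n (k + 1) l : ℝ) : ℂ)

/-- The matrix `[x̸, Γ]_{m,n;k,l} = γ⁰ [x⁰, Γ] + γ¹ [x¹, Γ]`. -/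
def commSlashX (γ0 γ1 : Matrix (Fin 2) (Fin 2) ℂ) (θ : ℝ) (Γ : ℕ → ℕ → ℕ → ℕ → ℝ)
    (m n k l : ℕ) : Matrix (Fin 2) (Fin 2) ℂ :=
  commX0 θ Γ m n k l • γ0 + commX1 θ Γ m n k l • γ1

/-- The matrix `[x̸̃, Γ]_{m,n;k,l}` for `x̃ = 2 Θ⁻¹ x`, `Θ = ((0, θ), (-θ, 0))`, that is,
`x̃⁰ = -(2/θ) x¹` and `x̃¹ = (2/θ) x⁰`. -/
def commSlashXTilde (γ0 γ1 : Matrix (Fin 2) (Fin 2) ℂ) (θ : ℝ) (Γ : ℕ → ℕ → ℕ → ℕ → ℝ)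
    (m n k l : ℕ) : Matrix (Fin 2) (Fin 2) ℂ :=
  (-((2 / θ : ℝ) : ℂ) * commX1 θ Γ m n k l) • γ0 + (((2 / θ : ℝ) : ℂ) * commX0 θ Γ m n k l) • γ1

/-- The spin factor `(2-α)/(2√(1-α)) 𝟙₂ - i α/(2√(1-α)) γ⁰γ¹`. -/
def spinFactor (γ0 γ1 : Matrix (Fin 2) (Fin 2) ℂ) (α : ℝ) : Matrix (Fin 2) (Fin 2) ℂ :=
  (((2 - α) / (2 * Real.sqrt (1 - α)) : ℝ) : ℂ) • (1 : Matrix (Fin 2) (Fin 2) ℂ)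
    - (Complex.I * ((α / (2 * Real.sqrt (1 - α)) : ℝ) : ℂ)) • (γ0 * γ1)

/-- The commutator part `G^{α,comm}_{m,n;k,l}`, with `Ω̃ = 2Ω/θ` and `B = Ω`. -/
def integrandComm (γ0 γ1 : Matrix (Fin 2) (Fin 2) ℂ) (Ω θ α : ℝ) (m n k l : ℕ) :
    Matrix (Fin 2) (Fin 2) ℂ :=
  ((Complex.I * ((2 * Ω / θ * ((2 - α) / α) : ℝ) : ℂ)) •
      commSlashX γ0 γ1 θ (kernelΓ Ω Ω α) m n k l
    + (Ω : ℂ) • commSlashXTilde γ0 γ1 θ (kernelΓ Ω Ω α) m n k l) * spinFactor γ0 γ1 α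

/-- The mass part `G^{α,mass}_{m,n;k,l}`, with `B = Ω`. -/
def integrandMass (γ0 γ1 : Matrix (Fin 2) (Fin 2) ℂ) (Ω μ α : ℝ) (m n k l : ℕ) :
    Matrix (Fin 2) (Fin 2) ℂ :=
  (-((μ * kernelΓ Ω Ω α m n k l : ℝ) : ℂ)) • spinFactor γ0 γ1 α

/-- The `i`-th slice of a matrix-valued density `F` (entrywise integral):
`-(2Ω/(θ²π²)) ∫_{M^{-i}}^{M^{-i+1}} F(α) dα`. -/
def slice (Ω θ M : ℝ) (i : ℕ) (F : ℝ → Matrix (Fin 2) (Fin 2) ℂ) : Matrix (Fin 2) (Fin 2) ℂ :=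
  fun a b => -((2 * Ω / (θ ^ 2 * Real.pi ^ 2) : ℝ) : ℂ) *
    ∫ α in (M ^ (-(i : ℤ)))..(M ^ (-(i : ℤ) + 1)), F α a b

/-- `G^{i,comm}_{m,n;k,l}`. -/
def sliceComm (γ0 γ1 : Matrix (Fin 2) (Fin 2) ℂ) (Ω θ M : ℝ) (i m n k l : ℕ) :
    Matrix (Fin 2) (Fin 2) ℂ :=
  slice Ω θ M i (fun α => integrandComm γ0 γ1 Ω θ α m n k l)

/-- `G^{i,mass}_{m,n;k,l}`. -/
def sliceMass (γ0 γ1 : Matrix (Fin 2) (Fin 2) ℂ) (Ω θ μ M : ℝ) (i m n k l : ℕ) :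
    Matrix (Fin 2) (Fin 2) ℂ :=
  slice Ω θ M i (fun α => integrandMass γ0 γ1 Ω μ α m n k l)

/-- The decay function of the bounds, with `s = M^{-i}`:
`exp(-c p²/(1+ks) - c s (h - k/(1+C))²/(1+k)) / (1 + √(ks)) + exp(-c k s - c p)`. -/
def decay (Ω c s k h p : ℝ) : ℝ :=
  Real.exp (-(c * p ^ 2 / (1 + k * s)) - c * s / (1 + k) * (h - k / (1 + constC Ω)) ^ 2) /
      (1 + Real.sqrt (k * s))
    + Real.exp (-(c * k * s) - c * p)

end NCGrossNeveu

end

open scoped Matrix Nat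

noncomputable section

namespace NCGrossNeveu

open Polynomial MeasureTheory

/-! The kernel is a disguised probability. With `a = parA Ω α` and `b = parB Ω α`, the entry
`Γ_{m,n;k,l}` equals, up to square roots of factorials and powers of `ratio Ω`, the coefficient of
`X^l` in `(1 - b + bX)^k (a + (1 - a)X)^m`, that is, the probability that a Bin(k, b) variable plus
an independent Bin(m, 1 - a) variable takes the value `l`. The symmetry `Γ_{m,n;k,l} = Γ_{l,k;n,m}`
gives a second such formula, with data `(n, l; m)`, whose prefactor is the reciprocal of the first.
Multiplying the two removes the prefactors: `Γ²` is a product of two probabilities (`kernelΓ_sq`).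

Each probability is bounded by a local limit theorem with a Bernstein tail: a Fourier integral over
a circle of tilted radius `exp s` yields the factor `(1 + bN)^(-1/2)` and a large deviation rate,
and first differences gain another `(1 + bN)^(-1/2)` (`exists_binomPoly_coeff_le`). The deviations
of the two laws jointly determine `p = l - m` and `h - k/(1+C)` up to bounded errors, so the sum of
the two rates dominates the exponent of `decay` (`exists_le_totalRate`). The regime `2p ≤ αk` gives
the Gaussian term, the opposite regime the exponential one.

The commutators contain a factor `1/α`, which has to be partly compensated. Their eight terms group
into four differences, and the square of each is a product in which one law contributes an exact
first difference times `a` or `b`, hence a factor of order `α` (`diffOuter_sq`, `diffInner_sq`).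
Each difference is thus `O(√α)` times `decay` (`exists_diff_le`). Integration over the slice, with
the integrable singularity `(1 - α)^(-1/2)` of the spin factor, gives `M^(-i/2)` for the commutator
part and `M^(-i)` for the mass part. -/

/-! ### Fourier coefficients on circles. -/

theorem integral_exp_int_mul_I (d : ℤ) :
    ∫ x in (-Real.pi)..Real.pi, Complex.exp (d * Complex.I * x) =
      if d = 0 then 2 * (Real.pi : ℂ) else 0 := by
  split_ifs with h
  · subst h; simp; ring
  · have hd : (d : ℂ) * Complex.I ≠ 0 := mul_ne_zero (by exact_mod_cast h) Complex.I_ne_zero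
    rw [integral_exp_mul_complex hd, div_eq_zero_iff]
    left
    rw [sub_eq_zero, Complex.exp_eq_exp_iff_exists_int]
    exact ⟨d, by push_cast; ring⟩

/-- Coefficient extraction on the circle of radius `ρ`. -/
theorem integral_aeval_circle (Q : ℝ[X]) (ρ : ℝ) (j : ℕ) :
    ∫ x in (-Real.pi)..Real.pi, aeval ((ρ : ℂ) * Complex.exp (x * Complex.I)) Q *
        Complex.exp (-(j : ℂ) * Complex.I * x) = 2 * Real.pi * (ρ : ℂ) ^ j * (Q.coeff j : ℂ) := by
  have h1 : ∀ x : ℝ, aeval ((ρ : ℂ) * Complex.exp (x * Complex.I)) Q *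
        Complex.exp (-(j : ℂ) * Complex.I * x) = ∑ i ∈ Finset.range (Q.natDegree + 1),
        ((Q.coeff i : ℂ) * (ρ : ℂ) ^ i) *
          Complex.exp ((((i : ℤ) - (j : ℤ) : ℤ) : ℂ) * Complex.I * x) := by
    intro x
    rw [aeval_eq_sum_range, Finset.sum_mul]
    refine Finset.sum_congr rfl fun i _ => ?_
    rw [mul_pow, ← Complex.exp_nat_mul, Complex.real_smul]
    have : Complex.exp ((((i : ℤ) - (j : ℤ) : ℤ) : ℂ) * Complex.I * x) =
        Complex.exp (i * (x * Complex.I)) * Complex.exp (-(j : ℂ) * Complex.I * x) := by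
      rw [← Complex.exp_add]; congr 1; push_cast; ring
    rw [this]; ring
  simp_rw [h1]
  rw [intervalIntegral.integral_finsetSum]
  · simp_rw [intervalIntegral.integral_const_mul, integral_exp_int_mul_I, sub_eq_zero, Nat.cast_inj]
    simp only [mul_ite, mul_zero, Finset.sum_ite_eq', Finset.mem_range]
    split_ifs with h
    · ring
    · rw [coeff_eq_zero_of_natDegree_lt (by omega)]; simp
  · intro i _
    exact Continuous.intervalIntegrable (by fun_prop) _ _

theorem abs_coeff_le_integral (Q : ℝ[X]) {ρ : ℝ} (hρ : 0 ≤ ρ) (j : ℕ) :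
    2 * Real.pi * ρ ^ j * |Q.coeff j| ≤
      ∫ x in (-Real.pi)..Real.pi, ‖aeval ((ρ : ℂ) * Complex.exp (x * Complex.I)) Q‖ := by
  have h := intervalIntegral.norm_integral_le_integral_norm (μ := volume)
    (f := fun x : ℝ => aeval ((ρ : ℂ) * Complex.exp (x * Complex.I)) Q *
        Complex.exp (-(j : ℂ) * Complex.I * x)) (a := -Real.pi) (b := Real.pi)
    (by linarith [Real.pi_pos])
  rw [integral_aeval_circle] at h
  have h2 : ∀ x : ℝ, ‖aeval ((ρ : ℂ) * Complex.exp (x * Complex.I)) Q *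
        Complex.exp (-(j : ℂ) * Complex.I * x)‖ =
        ‖aeval ((ρ : ℂ) * Complex.exp (x * Complex.I)) Q‖ := by
    intro x
    rw [norm_mul, Complex.norm_exp]; simp
  simp_rw [h2] at h
  refine le_trans (le_of_eq ?_) h
  simp [abs_of_pos Real.pi_pos, abs_of_nonneg hρ]

/-- `∫ exp(-cx²)` over a period, for `c > 0`. -/
theorem integral_exp_neg_sq_le {c : ℝ} (hc : 0 < c) :
    ∫ x in (-Real.pi)..Real.pi, Real.exp (-c * x ^ 2) ≤ Real.sqrt (Real.pi / c) := by
  rw [← integral_gaussian c, intervalIntegral.integral_of_le (by linarith [Real.pi_pos])]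
  exact setIntegral_le_integral (integrable_exp_neg_mul_sq hc)
    (Filter.Eventually.of_forall fun x => (Real.exp_pos _).le)

/-! ### Local limit bounds for a convolution of two binomial laws. -/

/-- The generating polynomial of the convolution of a binomial law with parameters `(N, b)` and a
binomial law with parameters `(L, 1 - a)`. -/
def binomPoly (a b : ℝ) (N L : ℕ) : ℝ[X] :=
  (C (1 - b) + C b * X) ^ N * (C a + C (1 - a) * X) ^ L

/-- The squared modulus falls below its value at `x = 0` by `2(1-b)bρ(1 - cos x)`, and `1 - cos x ≥
2x²/π²` on a period. The constant 14 leaves room for `(1 - b + bρ)² ≤ 9` and `ρ ≥ 1/3`: what is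
needed is `9/7 ≤ 4/3`. -/
theorem norm_add_mul_exp_le {b ρ x κ : ℝ} (hκ : κ ≤ 1 - b) (hκ0 : 0 ≤ κ) (hb : 0 ≤ b)
    (hρ1 : 1 / 3 ≤ ρ) (hρ2 : ρ ≤ 3) (hx : |x| ≤ Real.pi) :
    ‖((1 - b : ℝ) : ℂ) + (b : ℂ) * ((ρ : ℂ) * Complex.exp (x * Complex.I))‖ ≤
      (1 - b + b * ρ) * Real.exp (-(κ / (14 * Real.pi ^ 2)) * b * x ^ 2) := by
  have hs : 0 < 1 - b + b * ρ := by
    rcases hb.eq_or_lt with h | h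
    · subst h; norm_num
    · have := mul_pos h (by linarith : 0 < ρ); linarith
  have hsq : ‖((1 - b : ℝ) : ℂ) + (b : ℂ) * ((ρ : ℂ) * Complex.exp (x * Complex.I))‖ ^ 2 =
      (1 - b + b * ρ) ^ 2 - 2 * ((1 - b) * b * ρ) * (1 - Real.cos x) := by
    rw [← Complex.normSq_eq_norm_sq, Complex.exp_mul_I, Complex.normSq_apply]
    simp [Complex.cos_ofReal_re, Complex.sin_ofReal_re, Complex.cos_ofReal_im,
      Complex.sin_ofReal_im]
    linear_combination (b * ρ) ^ 2 * Real.sin_sq_add_cos_sq x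
  have hcos := Real.cos_le_one_sub_mul_cos_sq hx
  have hpi := Real.pi_pos
  have hs3 : 1 - b + b * ρ ≤ 3 := by nlinarith
  have hkey : (κ / (7 * Real.pi ^ 2)) * b * x ^ 2 * (1 - b + b * ρ) ^ 2 ≤
      2 * ((1 - b) * b * ρ) * (1 - Real.cos x) := by
    have e1 : (1 - b + b * ρ) ^ 2 ≤ 9 := by nlinarith
    have e2 : κ * b * (1 / 3) ≤ (1 - b) * b * ρ := by
      have : κ * b ≤ (1 - b) * b := mul_le_mul_of_nonneg_right hκ hb
      exact mul_le_mul this hρ1 (by norm_num) (mul_nonneg (by linarith) hb)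
    have e3 : 2 / Real.pi ^ 2 * x ^ 2 ≤ 1 - Real.cos x := by linarith
    have e4 : 0 ≤ 2 / Real.pi ^ 2 * x ^ 2 := by positivity
    have e5 : 0 ≤ κ * b * (1 / 3) := by positivity
    calc (κ / (7 * Real.pi ^ 2)) * b * x ^ 2 * (1 - b + b * ρ) ^ 2
        ≤ (κ / (7 * Real.pi ^ 2)) * b * x ^ 2 * 9 := by gcongr
      _ ≤ 2 * (κ * b * (1 / 3)) * (2 / Real.pi ^ 2 * x ^ 2) := by
          have : 0 ≤ κ * b * x ^ 2 / Real.pi ^ 2 := by positivity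
          have e : (κ / (7 * Real.pi ^ 2)) * b * x ^ 2 * 9 =
            (9 / 7) * (κ * b * x ^ 2 / Real.pi ^ 2) := by field_simp
          have e' : 2 * (κ * b * (1 / 3)) * (2 / Real.pi ^ 2 * x ^ 2) =
            (4 / 3) * (κ * b * x ^ 2 / Real.pi ^ 2) := by field_simp; ring
          rw [e, e']; linarith
      _ ≤ _ := by
          apply mul_le_mul _ e3 e4 (by nlinarith)
          linarith
  apply le_of_sq_le_sq _ (by positivity)
  rw [hsq, mul_pow, ← Real.exp_nat_mul]
  have h3 : ((2 : ℕ) : ℝ) * (-(κ / (14 * Real.pi ^ 2)) * b * x ^ 2) =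
      -((κ / (7 * Real.pi ^ 2)) * b * x ^ 2) := by
    push_cast; field_simp; ring
  rw [h3]
  have h4 := Real.one_sub_le_exp_neg ((κ / (7 * Real.pi ^ 2)) * b * x ^ 2)
  nlinarith [mul_le_mul_of_nonneg_left h4 (sq_nonneg (1 - b + b * ρ))]

theorem exp_sub_one_le_add_sq {x : ℝ} (hx : |x| ≤ 1) : Real.exp x - 1 ≤ x + x ^ 2 := by
  have := (abs_le.1 (Real.abs_exp_sub_one_sub_id_le hx)).2
  linarith

theorem exp_mem_of_abs_le_one {s : ℝ} (hs : |s| ≤ 1) :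
    1 / 3 ≤ Real.exp s ∧ Real.exp s ≤ 3 := by
  have h3 : Real.exp 1 ≤ 3 := by linarith [Real.exp_one_lt_d9]
  have hs' := abs_le.1 hs
  constructor
  · have h1 : Real.exp (-1) ≤ Real.exp s := Real.exp_le_exp.2 hs'.1
    rw [Real.exp_neg] at h1
    have : (1 / 3 : ℝ) ≤ (Real.exp 1)⁻¹ := by
      rw [one_div]; exact inv_anti₀ (Real.exp_pos 1) h3
    linarith
  · exact (Real.exp_le_exp.2 hs'.2).trans h3

/-- The exponentially tilted bound on the generating polynomial. -/
theorem norm_aeval_binomPoly_le {a b κ s x : ℝ} (ha : 0 ≤ a) (ha1 : a ≤ 1) (hb : 0 ≤ b)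
    (hκ0 : 0 ≤ κ) (hκ : κ ≤ 1 - b) (hs : |s| ≤ 1) (hx : |x| ≤ Real.pi) (N L : ℕ) :
    ‖aeval (((Real.exp s : ℝ) : ℂ) * Complex.exp (x * Complex.I)) (binomPoly a b N L)‖ ≤
      Real.exp (s * (L + b * N - a * L) + s ^ 2 * (b * N + a * L)) *
        Real.exp (-(κ / (14 * Real.pi ^ 2)) * (b * N) * x ^ 2) := by
  obtain ⟨hρ1, hρ2⟩ := exp_mem_of_abs_le_one hs
  set ρ := Real.exp s with hρ
  have hρ0 : 0 < ρ := Real.exp_pos s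
  have hg := norm_add_mul_exp_le hκ hκ0 hb hρ1 hρ2 hx
  -- No Gaussian decay is taken from this factor: the lemma allows `a = 1`, where there is none.
  -- Pulling out `exp s` makes the quadratic term proportional to `a` rather than to `1 - a`, so
  -- that the variance proxy `b N + a L` is small for small `α`.
  have hf : ‖(a : ℂ) + ((1 - a : ℝ) : ℂ) * ((ρ : ℂ) * Complex.exp (x * Complex.I))‖ ≤
      Real.exp (s + a * (-s + s ^ 2)) := by
    have h1 : ‖(a : ℂ) + ((1 - a : ℝ) : ℂ) * ((ρ : ℂ) * Complex.exp (x * Complex.I))‖ ≤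
        a + (1 - a) * ρ := by
      refine (norm_add_le _ _).trans (le_of_eq ?_)
      rw [norm_mul, norm_mul, Complex.norm_exp_ofReal_mul_I, Complex.norm_real, Complex.norm_real,
        Complex.norm_real, Real.norm_of_nonneg ha, Real.norm_of_nonneg (by linarith),
        Real.norm_of_nonneg hρ0.le, mul_one]
    have h2 : a + (1 - a) * ρ = Real.exp s * (1 + a * (Real.exp (-s) - 1)) := by
      have : Real.exp s * Real.exp (-s) = 1 := by rw [← Real.exp_add]; simp
      rw [hρ]; linear_combination (-a) * this
    have h3 : Real.exp (-s) - 1 ≤ -s + s ^ 2 := by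
      simpa using exp_sub_one_le_add_sq (x := -s) (by simpa using hs)
    have h4 : 1 + a * (Real.exp (-s) - 1) ≤ Real.exp (a * (-s + s ^ 2)) := by
      have := Real.add_one_le_exp (a * (-s + s ^ 2))
      have := mul_le_mul_of_nonneg_left h3 ha
      linarith
    rw [h2] at h1
    rw [Real.exp_add]
    exact h1.trans (mul_le_mul_of_nonneg_left h4 (Real.exp_pos s).le)
  have hg' : 1 - b + b * ρ ≤ Real.exp (b * (s + s ^ 2)) := by
    have h3 := exp_sub_one_le_add_sq hs
    have := Real.add_one_le_exp (b * (s + s ^ 2))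
    have := mul_le_mul_of_nonneg_left h3 hb
    rw [hρ]; linarith
  have hg2 := hg.trans (mul_le_mul_of_nonneg_right hg' (Real.exp_pos _).le)
  rw [← Real.exp_add] at hg2
  have e : aeval ((ρ : ℂ) * Complex.exp (x * Complex.I)) (binomPoly a b N L) =
      (((1 - b : ℝ) : ℂ) + (b : ℂ) * ((ρ : ℂ) * Complex.exp (x * Complex.I))) ^ N *
      ((a : ℂ) + ((1 - a : ℝ) : ℂ) * ((ρ : ℂ) * Complex.exp (x * Complex.I))) ^ L := by
    simp [binomPoly]
  rw [e, norm_mul, norm_pow, norm_pow]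
  calc _ ≤ Real.exp (b * (s + s ^ 2) + -(κ / (14 * Real.pi ^ 2)) * b * x ^ 2) ^ N *
        Real.exp (s + a * (-s + s ^ 2)) ^ L := by gcongr
    _ = _ := by
      rw [← Real.exp_nat_mul, ← Real.exp_nat_mul, ← Real.exp_add, ← Real.exp_add]
      congr 1; ring

theorem abs_mul_exp_neg_sq_le {c : ℝ} (hc : 0 < c) (x : ℝ) :
    |x| * Real.exp (-c * x ^ 2) ≤ (Real.sqrt c)⁻¹ * Real.exp (-(c / 2) * x ^ 2) := by
  have hsc := Real.sqrt_pos.2 hc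
  have h1 : Real.sqrt c * |x| ≤ Real.exp (c / 2 * x ^ 2) := by
    have h2 := Real.add_one_le_exp (c / 2 * x ^ 2)
    have h3 : (Real.sqrt c * |x|) ^ 2 = c * x ^ 2 := by
      rw [mul_pow, Real.sq_sqrt hc.le, sq_abs]
    nlinarith [sq_nonneg (Real.sqrt c * |x| - 1)]
  have h2 : Real.exp (-(c / 2) * x ^ 2) = Real.exp (c / 2 * x ^ 2) * Real.exp (-c * x ^ 2) := by
    rw [← Real.exp_add]; congr 1; ring
  rw [h2, ← mul_assoc]
  refine mul_le_mul_of_nonneg_right ?_ (Real.exp_pos _).le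
  rw [inv_mul_eq_div, le_div_iff₀ hsc, mul_comm]; exact h1

/-- A Gaussian bound on the circle of radius `exp s` bounds the coefficients. -/
theorem exists_abs_coeff_le {κ : ℝ} (hκ : 0 < κ) :
    ∃ K : ℝ, 0 < K ∧ ∀ (Q : ℝ[X]) (s G A B β : ℝ) (j : ℕ), 0 ≤ G → 0 ≤ A → 0 ≤ B → 0 ≤ β →
      (∀ x : ℝ, |x| ≤ Real.pi →
        ‖aeval (((Real.exp s : ℝ) : ℂ) * Complex.exp (x * Complex.I)) Q‖ ≤
          (A + B * |x|) * (G * Real.exp (-κ * β * x ^ 2))) →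
      |Q.coeff j| ≤ K * (A / Real.sqrt (1 + β) + B / (1 + β)) * (G * Real.exp (-(s * j))) := by
  have hpi := Real.pi_pos
  -- Since `|x| ≤ π`, the factor `exp(κπ²)` pays for replacing `β` by `1 + β` in the Gaussian, which
  -- makes the bound uniform down to `β = 0`.
  refine ⟨Real.exp (κ * Real.pi ^ 2) *
    (Real.sqrt (Real.pi / κ) + (Real.sqrt κ)⁻¹ * Real.sqrt (Real.pi / (κ / 2))), by positivity, ?_⟩
  intro Q s G A B β j hG hA hB hβ hQ
  have hβ1 : 0 < 1 + β := by linarith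
  set c := κ * (1 + β) with hc
  have hc0 : 0 < c := by positivity
  have hab : -Real.pi ≤ Real.pi := by linarith
  have h1 := abs_coeff_le_integral Q (Real.exp_pos s).le j
  have hpt : ∀ x ∈ Set.Icc (-Real.pi) Real.pi,
      ‖aeval (((Real.exp s : ℝ) : ℂ) * Complex.exp (x * Complex.I)) Q‖ ≤
      G * Real.exp (κ * Real.pi ^ 2) * A * Real.exp (-c * x ^ 2) +
      G * Real.exp (κ * Real.pi ^ 2) * B * (Real.sqrt c)⁻¹ * Real.exp (-(c / 2) * x ^ 2) := by
    intro x hx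
    have hx' : |x| ≤ Real.pi := abs_le.2 hx
    refine (hQ x hx').trans ?_
    have hE : Real.exp (-κ * β * x ^ 2) ≤
        Real.exp (κ * Real.pi ^ 2) * Real.exp (-c * x ^ 2) := by
      rw [← Real.exp_add]
      apply Real.exp_le_exp.2
      have : x ^ 2 ≤ Real.pi ^ 2 := sq_le_sq' hx.1 hx.2
      have := mul_le_mul_of_nonneg_left this hκ.le
      rw [hc]; linarith
    have hX := abs_mul_exp_neg_sq_le hc0 x
    calc _ ≤ (A + B * |x|) * (G * (Real.exp (κ * Real.pi ^ 2) * Real.exp (-c * x ^ 2))) := by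
          gcongr
      _ = G * Real.exp (κ * Real.pi ^ 2) * A * Real.exp (-c * x ^ 2) +
        G * Real.exp (κ * Real.pi ^ 2) * B * (|x| * Real.exp (-c * x ^ 2)) := by ring
      _ ≤ G * Real.exp (κ * Real.pi ^ 2) * A * Real.exp (-c * x ^ 2) +
        G * Real.exp (κ * Real.pi ^ 2) * B *
          ((Real.sqrt c)⁻¹ * Real.exp (-(c / 2) * x ^ 2)) := by gcongr
      _ = _ := by ring
  have hcont : Continuous fun x : ℝ =>
      ‖aeval (((Real.exp s : ℝ) : ℂ) * Complex.exp (x * Complex.I)) Q‖ := by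
    have : Continuous fun z : ℂ => aeval z Q := Polynomial.continuous_aeval Q
    fun_prop
  have h2 := intervalIntegral.integral_mono_on hab (hcont.intervalIntegrable (μ := volume) _ _)
    (Continuous.intervalIntegrable (by fun_prop) _ _) hpt
  rw [intervalIntegral.integral_add (Continuous.intervalIntegrable (by fun_prop) _ _)
    (Continuous.intervalIntegrable (by fun_prop) _ _), intervalIntegral.integral_const_mul,
    intervalIntegral.integral_const_mul] at h2
  have h3 := integral_exp_neg_sq_le hc0
  have h4 := integral_exp_neg_sq_le (half_pos hc0)
  have h5 : Real.sqrt (Real.pi / c) = Real.sqrt (Real.pi / κ) / Real.sqrt (1 + β) := by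
    rw [← Real.sqrt_div (by positivity), hc, div_div]
  have h6 : Real.sqrt (Real.pi / (c / 2)) =
      Real.sqrt (Real.pi / (κ / 2)) / Real.sqrt (1 + β) := by
    rw [← Real.sqrt_div (by positivity), hc, div_div]; congr 2; ring
  have h7 : (Real.sqrt c)⁻¹ = (Real.sqrt κ)⁻¹ / Real.sqrt (1 + β) := by
    rw [hc, Real.sqrt_mul hκ.le, mul_inv]; rfl
  rw [h5] at h3
  rw [h6] at h4
  rw [h7] at h2
  set E := Real.exp (κ * Real.pi ^ 2)
  set S := Real.sqrt (1 + β) with hS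
  have hS0 : 0 < S := Real.sqrt_pos.2 hβ1
  have hSS : S * S = 1 + β := Real.mul_self_sqrt hβ1.le
  set p1 := Real.sqrt (Real.pi / κ)
  set p2 := (Real.sqrt κ)⁻¹
  set p3 := Real.sqrt (Real.pi / (κ / 2))
  have hp1 : 0 ≤ p1 := Real.sqrt_nonneg _
  have hp2 : 0 ≤ p2 := inv_nonneg.2 (Real.sqrt_nonneg _)
  have hp3 : 0 ≤ p3 := Real.sqrt_nonneg _
  have hE0 : 0 < E := Real.exp_pos _
  have h8 : 2 * Real.pi * Real.exp s ^ j * |Q.coeff j| ≤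
      E * (p1 + p2 * p3) * (A / S + B / (1 + β)) * G := by
    refine (h1.trans h2).trans ?_
    calc _ ≤ G * E * A * (p1 / S) + G * E * B * (p2 / S) * (p3 / S) := by gcongr
      _ = E * (p1 * (A / S) + p2 * p3 * (B / (1 + β))) * G := by
          rw [← hSS]; field_simp
      _ ≤ _ := by
        have : 0 ≤ A / S := by positivity
        have : 0 ≤ B / (1 + β) := by positivity
        refine mul_le_mul_of_nonneg_right ?_ hG
        rw [mul_assoc E (p1 + p2 * p3)]
        refine mul_le_mul_of_nonneg_left ?_ hE0.le
        nlinarith [mul_nonneg hp1 this, mul_nonneg (mul_nonneg hp2 hp3) ‹0 ≤ A / S›]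
  have h9 : Real.exp s ^ j * Real.exp (-(s * j)) = 1 := by
    rw [← Real.exp_nat_mul, ← Real.exp_add]; simp [mul_comm]
  have hpi1 : 1 ≤ 2 * Real.pi := by linarith [Real.pi_gt_three]
  calc |Q.coeff j| = (Real.exp s ^ j * |Q.coeff j|) * Real.exp (-(s * j)) := by
        rw [mul_right_comm, h9, one_mul]
    _ ≤ (2 * Real.pi * (Real.exp s ^ j * |Q.coeff j|)) * Real.exp (-(s * j)) := by
        refine mul_le_mul_of_nonneg_right ?_ (Real.exp_pos _).le
        exact le_mul_of_one_le_left (by positivity) hpi1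
    _ = (2 * Real.pi * Real.exp s ^ j * |Q.coeff j|) * Real.exp (-(s * j)) := by ring
    _ ≤ (E * (p1 + p2 * p3) * (A / S + B / (1 + β)) * G) * Real.exp (-(s * j)) := by gcongr
    _ = _ := by ring

/-- The Bernstein-type large deviation rate. -/
def tiltRate (V t : ℝ) : ℝ := t ^ 2 / (2 * V + |t|)

/-- The tilt `s = t/(2V + |t|)` is a near-minimizer of `-st + s²V` that stays in `[-1, 1]`, where
the quadratic bound on `exp` is available. -/
theorem tilt_exponent_le {V v t : ℝ} (hV : 0 < V) (hv : v ≤ V) :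
    -(t / (2 * V + |t|)) * t + (t / (2 * V + |t|)) ^ 2 * v ≤ -(tiltRate V t) / 2 := by
  have ht := abs_nonneg t
  have hS : 0 < 2 * V + |t| := by linarith
  have h1 : (t / (2 * V + |t|)) ^ 2 * v ≤ tiltRate V t / 2 := by
    rw [tiltRate, div_pow, div_mul_eq_mul_div, div_div, div_le_div_iff₀ (by positivity)
      (by positivity)]
    have : t ^ 2 * v * 2 ≤ t ^ 2 * (2 * V + |t|) := by nlinarith [sq_nonneg t]
    nlinarith [mul_le_mul_of_nonneg_right this hS.le]
  have h2 : -(t / (2 * V + |t|)) * t = -tiltRate V t := by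
    rw [tiltRate]; ring
  rw [h2]; linarith

theorem abs_div_le_one {V t : ℝ} (hV : 0 < V) : |t / (2 * V + |t|)| ≤ 1 := by
  have ht := abs_nonneg t
  rw [abs_div, abs_of_pos (by linarith : 0 < 2 * V + |t|), div_le_one (by linarith)]
  linarith

/-- On the tilted circle `1 - X` does not vanish at angle 0 but has size of order `|s|`. Half of the
rate is spent on turning `|s|` into `V^(-1/2)`, the gain expected of a first difference. -/
theorem abs_tilt_mul_exp_le {V t : ℝ} (hV : 0 < V) :
    |t / (2 * V + |t|)| * Real.exp (-(tiltRate V t) / 2) ≤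
      Real.exp (-(tiltRate V t) / 4) / Real.sqrt V := by
  have ht := abs_nonneg t
  have hS : 0 < 2 * V + |t| := by linarith
  have hsV := Real.sqrt_pos.2 hV
  set w := tiltRate V t with hw
  have hw0 : 0 ≤ w := div_nonneg (sq_nonneg _) hS.le
  have h1 : Real.exp (-w / 2) = Real.exp (-w / 4) * Real.exp (-w / 4) := by
    rw [← Real.exp_add]; congr 1; ring
  have h2 : (|t / (2 * V + |t|)| * Real.sqrt V) ^ 2 ≤ w / 2 := by
    rw [mul_pow, Real.sq_sqrt hV.le, sq_abs, hw, tiltRate, div_pow, div_div,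
      div_mul_eq_mul_div, div_le_div_iff₀ (by positivity) (by positivity)]
    have : t ^ 2 * V * 2 ≤ t ^ 2 * (2 * V + |t|) := by nlinarith [sq_nonneg t]
    nlinarith [mul_le_mul_of_nonneg_right this hS.le]
  have h3 : |t / (2 * V + |t|)| * Real.sqrt V ≤ Real.exp (w / 4) := by
    have h4 := Real.add_one_le_exp (w / 4)
    have h0 : 0 ≤ |t / (2 * V + |t|)| * Real.sqrt V := by positivity
    nlinarith [sq_nonneg (|t / (2 * V + |t|)| * Real.sqrt V - 1)]
  have h5 : Real.exp (w / 4) * Real.exp (-w / 4) = 1 := by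
    rw [← Real.exp_add]; simp [neg_div]
  rw [le_div_iff₀ hsV, h1]
  calc |t / (2 * V + |t|)| * (Real.exp (-w / 4) * Real.exp (-w / 4)) * Real.sqrt V
      = (|t / (2 * V + |t|)| * Real.sqrt V) * Real.exp (-w / 4) * Real.exp (-w / 4) := by ring
    _ ≤ Real.exp (w / 4) * Real.exp (-w / 4) * Real.exp (-w / 4) := by gcongr
    _ = _ := by rw [h5, one_mul]

/-- Local limit bound for the coefficients of `binomPoly` and of their first differences. -/
theorem exists_binomPoly_coeff_le {κ : ℝ} (hκ : 0 < κ) :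
    ∃ K : ℝ, 0 < K ∧ ∀ (a b V : ℝ) (N L j : ℕ), 0 ≤ a → a ≤ 1 → 0 ≤ b → κ ≤ 1 - b →
      1 + b * N + a * L ≤ V →
      |(binomPoly a b N L).coeff j| ≤ K / Real.sqrt (1 + b * N) *
          Real.exp (-(tiltRate V (j - L - b * N + a * L)) / 2) ∧
      |((1 - X) * binomPoly a b N L).coeff j| ≤ K / (1 + b * N) *
          Real.exp (-(tiltRate V (j - L - b * N + a * L)) / 4) := by
  obtain ⟨K, hK, H⟩ := exists_abs_coeff_le (κ := κ / (14 * Real.pi ^ 2))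
    (by have := Real.pi_pos; positivity)
  refine ⟨6 * K, by positivity, ?_⟩
  intro a b V N L j ha ha1 hb hκb hV
  have hbN : 0 ≤ b * N := by positivity
  have haL : 0 ≤ a * L := by positivity
  have hV0 : 0 < V := by linarith
  -- The mean of the law is `b N + (1 - a) L`, so `t` is the deviation of `j` from it.
  set t : ℝ := j - L - b * N + a * L with ht
  set s := t / (2 * V + |t|) with hs
  have hs1 : |s| ≤ 1 := abs_div_le_one hV0
  have hexp : Real.exp (s * (L + b * N - a * L) + s ^ 2 * (b * N + a * L)) *
      Real.exp (-(s * j)) ≤ Real.exp (-(tiltRate V t) / 2) := by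
    rw [← Real.exp_add]
    apply Real.exp_le_exp.2
    have := tilt_exponent_le (v := b * N + a * L) (t := t) hV0 (by linarith)
    refine le_trans (le_of_eq ?_) this
    rw [← hs, ht]; ring
  set w := tiltRate V t
  have hsq0 : 0 < Real.sqrt (1 + b * N) := Real.sqrt_pos.2 (by linarith)
  constructor
  · have h1 := H (binomPoly a b N L) s _ 1 0 (b * N) j (Real.exp_pos _).le zero_le_one le_rfl hbN
      (fun x hx => by
        have := norm_aeval_binomPoly_le (N := N) (L := L) ha ha1 hb hκ.le hκb hs1 hx
        simpa using this)
    refine h1.trans ?_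
    rw [zero_div, add_zero, mul_one_div]
    gcongr
    linarith
  -- At `exp(s + ix)` the factor `1 - X` is bounded by `2|s| + 3|x|`: the radial and the angular
  -- displacement from 1.
  · have h1 := H ((1 - X) * binomPoly a b N L) s _ (2 * |s|) 3 (b * N) j (Real.exp_pos _).le
      (by positivity) (by norm_num) hbN (fun x hx => by
        have h2 := norm_aeval_binomPoly_le (N := N) (L := L) ha ha1 hb hκ.le hκb hs1 hx
        rw [map_mul, norm_mul]
        refine mul_le_mul ?_ h2 (norm_nonneg _) (by positivity)
        have h3 : aeval (((Real.exp s : ℝ) : ℂ) * Complex.exp (x * Complex.I)) (1 - X : ℝ[X]) =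
          -((Real.exp s - 1 : ℝ) : ℂ) -
            ((Real.exp s : ℝ) : ℂ) * (Complex.exp (Complex.I * x) - 1) := by
          simp only [map_sub, map_one, aeval_X, Complex.ofReal_sub, Complex.ofReal_one,
            mul_comm (x : ℂ)]
          ring
        rw [h3]
        refine (norm_sub_le _ _).trans ?_
        rw [norm_neg, norm_mul, Complex.norm_real, Complex.norm_real,
          Real.norm_of_nonneg (Real.exp_pos s).le, Real.norm_eq_abs]
        refine add_le_add (Real.abs_exp_sub_one_le hs1) ?_
        exact mul_le_mul (exp_mem_of_abs_le_one hs1).2 Real.norm_exp_I_mul_ofReal_sub_one_le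
          (norm_nonneg _) (by norm_num))
    refine h1.trans ?_
    have hw4 : Real.exp (-w / 2) ≤ Real.exp (-w / 4) := by
      apply Real.exp_le_exp.2
      have : 0 ≤ w := div_nonneg (sq_nonneg _) (by have := abs_nonneg t; linarith)
      linarith
    have h5 := abs_tilt_mul_exp_le (t := t) hV0
    rw [← hs] at h5
    have h6 : Real.exp (-w / 4) / Real.sqrt V ≤ Real.exp (-w / 4) / Real.sqrt (1 + b * N) := by
      gcongr; linarith
    have hss : Real.sqrt (1 + b * N) * Real.sqrt (1 + b * N) = 1 + b * N :=
      Real.mul_self_sqrt (by linarith)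
    set S := Real.sqrt (1 + b * N)
    calc _ ≤ K * (2 * |s| / S + 3 / (1 + b * N)) * Real.exp (-w / 2) := by gcongr
      _ = K * (2 * (|s| * Real.exp (-w / 2)) / S + 3 / (1 + b * N) * Real.exp (-w / 2)) := by ring
      _ ≤ K * (2 * (Real.exp (-w / 4) / S) / S + 3 / (1 + b * N) * Real.exp (-w / 4)) := by
          gcongr; exact h5.trans h6
      _ = 5 * K / (1 + b * N) * Real.exp (-w / 4) := by
          rw [← hss]; field_simp; ring
      _ ≤ _ := by gcongr; norm_num

/-! ### The kernel as a coefficient of the generating polynomial. -/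

theorem coeff_C_add_C_mul_X_pow (c d : ℝ) (N u : ℕ) :
    ((C c + C d * X) ^ N).coeff u = if u ≤ N then (N.choose u : ℝ) * d ^ u * c ^ (N - u) else 0 := by
  rw [add_comm, add_pow, finsetSum_coeff]
  have h : ∀ i ∈ Finset.range (N + 1), ((C d * X) ^ i * C c ^ (N - i) * (N.choose i : ℝ[X])).coeff u =
      if u = i then (N.choose i : ℝ) * d ^ i * c ^ (N - i) else 0 := by
    intro i _
    have : (C d * X) ^ i * C c ^ (N - i) * (N.choose i : ℝ[X]) =
        C ((N.choose i : ℝ) * d ^ i * c ^ (N - i)) * X ^ i := by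
      simp only [mul_pow, map_mul, map_pow, map_natCast]; ring
    rw [this, coeff_C_mul_X_pow]
  rw [Finset.sum_congr rfl h, Finset.sum_ite_eq]
  simp

/-- The range of the kernel sum is exactly where both binomial coefficients survive: `u < m - n`
means `l - u > k`. -/
theorem coeff_binomPoly (a b : ℝ) {m n k l : ℕ} (h : n + l = k + m) :
    (binomPoly a b k m).coeff l = ∑ u ∈ Finset.Icc (m - n) (min m l),
      (m.choose u : ℝ) * (1 - a) ^ u * a ^ (m - u) *
        ((k.choose (l - u) : ℝ) * b ^ (l - u) * (1 - b) ^ (k - (l - u))) := by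
  rw [binomPoly, mul_comm, coeff_mul, Finset.Nat.sum_antidiagonal_eq_sum_range_succ_mk]
  symm
  have hsub : Finset.Icc (m - n) (min m l) ⊆ Finset.range (l + 1) := by
    intro u hu
    simp only [Finset.mem_Icc, Finset.mem_range] at *
    omega
  rw [← Finset.sum_subset hsub]
  · refine Finset.sum_congr rfl fun u hu => ?_
    simp only [Finset.mem_Icc] at hu
    rw [coeff_C_add_C_mul_X_pow, coeff_C_add_C_mul_X_pow, if_pos (by omega), if_pos (by omega)]
  · intro u hu hu'
    simp only [Finset.mem_Icc, Finset.mem_range] at *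
    rw [coeff_C_add_C_mul_X_pow, coeff_C_add_C_mul_X_pow]
    by_cases h1 : u ≤ m
    · rw [if_neg (by omega : ¬ (l - u ≤ k)), mul_zero]
    · rw [if_neg h1, zero_mul]

theorem natDegree_binomPoly_le (a b : ℝ) (N L : ℕ) : (binomPoly a b N L).natDegree ≤ N + L := by
  have h (c d : ℝ) (M : ℕ) : ((C c + C d * X) ^ M).natDegree ≤ M := by
    refine natDegree_pow_le.trans ?_
    refine (Nat.mul_le_mul_left M (m := 1) ?_).trans (mul_one M).le
    compute_degree
  exact natDegree_mul_le.trans (add_le_add (h _ _ N) (h _ _ L))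

theorem kernelΓ_symm (Ω B α : ℝ) (m n k l : ℕ) : kernelΓ Ω B α l k n m = kernelΓ Ω B α m n k l := by
  unfold kernelΓ
  by_cases h : n + l = k + m
  · rw [if_pos h, if_pos h.symm, ← h]
    have e1 : (k : ℝ) - l = n - m := by
      have : (n : ℝ) + l = k + m := by exact_mod_cast h
      linarith
    rw [e1, show l - k = m - n by omega, min_comm, show l + m = m + l from add_comm _ _]
    congr 1
    refine Finset.sum_congr rfl fun u hu => ?_
    simp only [Finset.mem_Icc] at hu
    congr 1
    unfold combA
    rw [show k + u - l = n + u - m by omega]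
    congr 1
    · congr 1; ring
    · ring
  · rw [if_neg h, if_neg (fun h' => h h'.symm)]

theorem sqrt_mul_combA {m n k l u : ℕ} (h : n + l = k + m) (h1 : m - n ≤ u) (h2 : u ≤ min m l) :
    Real.sqrt ((m ! : ℝ) * k !) * combA m n k l u =
      Real.sqrt ((n ! : ℝ) * l !) * ((m.choose u : ℝ) * (k.choose (l - u) : ℝ)) := by
  have e1 : (m ! : ℝ) * (n ! : ℝ) * (l ! : ℝ) * (k ! : ℝ) = (m ! * k !) * (n ! * l !) := by ring
  rw [combA, e1, Real.sqrt_mul (show (0 : ℝ) ≤ (m ! : ℝ) * (k ! : ℝ) by positivity)]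
  have e2 : Real.sqrt ((m ! : ℝ) * k !) * Real.sqrt ((m ! : ℝ) * k !) = m ! * k ! :=
    Real.mul_self_sqrt (by positivity)
  rw [Nat.cast_choose ℝ (by omega : u ≤ m), Nat.cast_choose ℝ (by omega : l - u ≤ k),
    show k - (l - u) = n + u - m by omega]
  have p1 := Nat.cast_ne_zero (R := ℝ).2 (Nat.factorial_ne_zero u)
  have p2 := Nat.cast_ne_zero (R := ℝ).2 (Nat.factorial_ne_zero (m - u))
  have p3 := Nat.cast_ne_zero (R := ℝ).2 (Nat.factorial_ne_zero (l - u))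
  have p4 := Nat.cast_ne_zero (R := ℝ).2 (Nat.factorial_ne_zero (n + u - m))
  rw [mul_div_assoc', ← mul_assoc, e2]
  field_simp

variable {Ω α : ℝ}

theorem constC_pos (hΩ : 0 < Ω) (hΩ1 : Ω ≠ 1) : 0 < constC Ω := by
  unfold constC
  have : 0 < (1 - Ω) ^ 2 := by
    have : 1 - Ω ≠ 0 := sub_ne_zero.2 hΩ1.symm
    positivity
  positivity

/-- Binomial parameter `(1 + C) α / (1 + C α)`. -/
def parA (Ω α : ℝ) : ℝ := (1 + constC Ω) * α / (1 + constC Ω * α)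

/-- Binomial parameter `C α / (1 + C α)`. -/
def parB (Ω α : ℝ) : ℝ := constC Ω * α / (1 + constC Ω * α)

/-- The generating polynomial of the kernel. -/
def kernelPoly (Ω α : ℝ) (N L : ℕ) : ℝ[X] := binomPoly (parA Ω α) (parB Ω α) N L

/-- The signed square root of `C / (1 + C)`. -/
def ratio (Ω : ℝ) : ℝ := (1 - Ω) / (1 + Ω)

theorem ratio_ne_zero (hΩ : 0 < Ω) (hΩ1 : Ω ≠ 1) : ratio Ω ≠ 0 :=
  div_ne_zero (sub_ne_zero.2 hΩ1.symm) (by linarith)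

/-- The terms agree one by one in `u`. The factorials match by `sqrt_mul_combA`; the powers match
because `1 - a = (1-α)/(1+Cα)`, `1 - b = 1/(1+Cα)`, and `a`, `b` differ by the factor `ratio Ω ^ 2 =
C/(1+C)`. -/
theorem kernelΓ_eq_coeff (hΩ : 0 < Ω) (hΩ1 : Ω ≠ 1) (hα : 0 < α) (hα1 : α < 1) {m n k l : ℕ}
    (h : n + l = k + m) :
    Real.sqrt ((m ! : ℝ) * k !) * ratio Ω ^ l * kernelΓ Ω Ω α m n k l =
      Real.sqrt ((n ! : ℝ) * l !) * ratio Ω ^ m * (kernelPoly Ω α k m).coeff l := by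
  have hC := constC_pos hΩ hΩ1
  have hq : 0 < 1 + constC Ω * α := by positivity
  have hr := ratio_ne_zero hΩ hΩ1
  have h1Ω : (1 + Ω) ≠ 0 := by linarith
  have h1Ω' : (1 - Ω) ≠ 0 := sub_ne_zero.2 hΩ1.symm
  rw [kernelPoly, coeff_binomPoly _ _ h, kernelΓ, if_pos h]
  have hy2 : Real.sqrt (1 - α) ^ 2 = 1 - α := Real.sq_sqrt (by linarith)
  have hy : 0 < Real.sqrt (1 - α) := Real.sqrt_pos.2 (by linarith)
  -- The choice `B = Ω` makes the exponent `-h/2`, hence an integer power of `√(1-α)`.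
  have hrp : (1 - α) ^ (-(Ω * ((n : ℝ) - (m : ℝ)) / (2 * Ω))) =
      Real.sqrt (1 - α) ^ ((m : ℤ) - (n : ℤ)) := by
    rw [Real.sqrt_eq_rpow, ← Real.rpow_intCast, ← Real.rpow_mul (by linarith)]
    congr 1; push_cast; field_simp; ring
  rw [hrp]
  set y := Real.sqrt (1 - α) with hydef
  set q := 1 + constC Ω * α with hqdef
  set r := ratio Ω with hrdef
  rw [Finset.mul_sum, Finset.mul_sum, Finset.mul_sum]
  refine Finset.sum_congr rfl fun u hu => ?_
  rw [Finset.mem_Icc] at hu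
  obtain ⟨hu1, hu2⟩ := hu
  have hA := sqrt_mul_combA h hu1 hu2
  have ea : 1 - parA Ω α = y ^ 2 / q := by rw [parA, hy2]; field_simp; rw [hqdef]; ring
  have eb : 1 - parB Ω α = 1 / q := by rw [parB, ← hqdef]; field_simp; rw [hqdef]; ring
  -- `D` is the geometric mean of the numerators of `a` and `b` up to the sign of `ratio Ω`; in
  -- terms of `D` and `r` the identity `key` is a comparison of monomials.
  set D := (1 + constC Ω) * r * α with hD
  have ea' : parA Ω α = D / (r * q) := by rw [parA, ← hqdef, hD]; field_simp
  have eD : constC Ω * α = D * r := by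
    rw [hD, hrdef, ratio, constC]; field_simp; ring
  have eb' : parB Ω α = D * r / q := by rw [parB, ← hqdef, eD]
  have et : constC Ω * α * (1 + Ω) / (y * (1 - Ω)) = D / y := by
    rw [eD, hrdef, ratio]; field_simp
  rw [ea, eb, ea', eb', et]
  obtain ⟨v, rfl⟩ : ∃ v, m = u + v := ⟨m - u, by omega⟩
  obtain ⟨w, rfl⟩ : ∃ w, l = u + w := ⟨l - u, by omega⟩
  obtain ⟨z, rfl⟩ : ∃ z, k = w + z := ⟨k - w, by omega⟩
  have hn : n = z + v := by omega
  subst hn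
  have x1 : u + v - u = v := by omega
  have x2 : u + w - u = w := by omega
  have x3 : w + z - w = z := by omega
  have x4 : u + v + (u + w) - 2 * u = v + w := by omega
  rw [x2] at hA
  rw [x1, x2, x3, x4]
  have hz : y ^ (((u + v : ℕ) : ℤ) - ((z + v : ℕ) : ℤ)) = y ^ u / y ^ z := by
    rw [← zpow_natCast y u, ← zpow_natCast y z, ← zpow_sub₀ hy.ne']; congr 1; push_cast; ring
  rw [hz]
  have key : r ^ (u + w) * ((y / q) ^ (z + v + (u + w)) * (y ^ u / y ^ z) * (D / y) ^ (v + w)) =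
      r ^ (u + v) * ((y ^ 2 / q) ^ u * (D / (r * q)) ^ v * ((D * r / q) ^ w * (1 / q) ^ z)) := by
    simp only [div_pow, mul_pow, pow_add, one_pow, sq]
    field_simp
  calc _ = (Real.sqrt (((u + v)! : ℝ) * ((w + z)! : ℝ)) *
        combA (u + v) (z + v) (w + z) (u + w) u) * (r ^ (u + w) *
        ((y / q) ^ (z + v + (u + w)) * (y ^ u / y ^ z) * (D / y) ^ (v + w))) := by ring
    _ = _ := by rw [key, hA]; ring

theorem kernelΓ_eq_coeff' (hΩ : 0 < Ω) (hΩ1 : Ω ≠ 1) (hα : 0 < α) (hα1 : α < 1) {m n k l : ℕ}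
    (h : n + l = k + m) :
    Real.sqrt ((n ! : ℝ) * l !) * ratio Ω ^ m * kernelΓ Ω Ω α m n k l =
      Real.sqrt ((m ! : ℝ) * k !) * ratio Ω ^ l * (kernelPoly Ω α n l).coeff m := by
  have := kernelΓ_eq_coeff hΩ hΩ1 hα hα1 h.symm
  rwa [kernelΓ_symm, mul_comm (l ! : ℝ), mul_comm (k ! : ℝ)] at this

/-- The prefactors `p` and `q` trade places between the two representations of the same quantity, so
they cancel in the square. -/
theorem mul_eq_of_dual {p q x u v : ℝ} (hp : p ≠ 0) (hq : q ≠ 0) (h1 : p * x = q * u)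
    (h2 : q * x = p * v) : x ^ 2 = u * v := by
  have : p * q * x ^ 2 = p * q * (u * v) := by linear_combination q * x * h1 + q * u * h2
  exact mul_left_cancel₀ (mul_ne_zero hp hq) this

theorem kernelΓ_sq (hΩ : 0 < Ω) (hΩ1 : Ω ≠ 1) (hα : 0 < α) (hα1 : α < 1) {m n k l : ℕ}
    (h : n + l = k + m) : kernelΓ Ω Ω α m n k l ^ 2 =
      (kernelPoly Ω α k m).coeff l * (kernelPoly Ω α n l).coeff m := by
  have hr := ratio_ne_zero hΩ hΩ1
  exact mul_eq_of_dual (by positivity) (by positivity) (kernelΓ_eq_coeff hΩ hΩ1 hα hα1 h)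
    (kernelΓ_eq_coeff' hΩ hΩ1 hα hα1 h)

/-! ### Squares of the kernel differences. -/

/-- The difference `√(m+1) Γ_{m+1,n;k,l} - √l Γ_{m,n;k,l-1}`. -/
def diffOuter (Ω α : ℝ) (m n k l : ℕ) : ℝ :=
  Real.sqrt (m + 1) * kernelΓ Ω Ω α (m + 1) n k l - Real.sqrt l * kernelΓ Ω Ω α m n k (l - 1)

/-- The difference `√(n+1) Γ_{m,n+1;k,l} - √k Γ_{m,n;k-1,l}`. -/
def diffInner (Ω α : ℝ) (m n k l : ℕ) : ℝ :=
  Real.sqrt (n + 1) * kernelΓ Ω Ω α m (n + 1) k l - Real.sqrt k * kernelΓ Ω Ω α m n (k - 1) l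

theorem sqrt_factorial_succ (m : ℕ) (x : ℝ) :
    Real.sqrt (((m + 1)! : ℝ) * x) = Real.sqrt (m + 1) * Real.sqrt (m ! * x) := by
  rw [← Real.sqrt_mul (by positivity)]; congr 1; push_cast [Nat.factorial_succ]; ring

theorem sqrt_factorial_succ' (m : ℕ) (x : ℝ) :
    Real.sqrt (x * ((m + 1)! : ℝ)) = Real.sqrt (m + 1) * Real.sqrt (x * m !) := by
  rw [mul_comm, sqrt_factorial_succ, mul_comm x]

/-- In the first representation the square roots are absorbed by the factorials and the difference
is exact: `P_{k,m+1} - X P_{k,m} = a (1 - X) P_{k,m}`. In the dual one they become the unequal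
weights `m + 1` and `l`, which leaves a difference weighted by `l` plus an undifferenced term of
weight `m + 1 - l`. Only one factor `a` can therefore be extracted from the square. -/
theorem diffOuter_sq (hΩ : 0 < Ω) (hΩ1 : Ω ≠ 1) (hα : 0 < α) (hα1 : α < 1) {m n k l : ℕ}
    (h : n + l = k + m + 1) : diffOuter Ω α m n k l ^ 2 =
      (parA Ω α * ((1 - X) * kernelPoly Ω α k m).coeff l) *
      (((m : ℝ) + 1 - l) * (kernelPoly Ω α n l).coeff (m + 1) +
        l * parA Ω α * ((1 - X) * kernelPoly Ω α n (l - 1)).coeff (m + 1)) := by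
  have hr := ratio_ne_zero hΩ hΩ1
  set r := ratio Ω
  have hm : Real.sqrt ((m : ℝ) + 1) * Real.sqrt ((m : ℝ) + 1) = m + 1 :=
    Real.mul_self_sqrt (by positivity)
  have a1 := kernelΓ_eq_coeff hΩ hΩ1 hα hα1 (show n + l = k + (m + 1) by omega)
  have b1 := kernelΓ_eq_coeff' hΩ hΩ1 hα hα1 (show n + l = k + (m + 1) by omega)
  rw [sqrt_factorial_succ] at a1 b1
  have ePoly : kernelPoly Ω α k (m + 1) = X * kernelPoly Ω α k m +
      C (parA Ω α) * ((1 - X) * kernelPoly Ω α k m) := by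
    simp only [kernelPoly, binomPoly, map_sub, map_one]; ring
  refine mul_eq_of_dual (p := Real.sqrt ((m ! : ℝ) * k !) * r ^ l)
    (q := Real.sqrt ((n ! : ℝ) * l !) * r ^ (m + 1)) (by positivity) (by positivity) ?_ ?_
  · rw [ePoly, coeff_add, coeff_C_mul] at a1
    -- At `l = 0` the truncated index `l - 1` carries `√0`, and `X * P` has no constant coefficient.
    rcases l with _ | l
    · simp only [diffOuter, mul_coeff_zero, coeff_X_zero, zero_mul, zero_add, Nat.cast_zero,
        Real.sqrt_zero, sub_zero] at *
      linear_combination a1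
    · have a2 := kernelΓ_eq_coeff hΩ hΩ1 hα hα1 (show n + l = k + m by omega)
      rw [coeff_X_mul] at a1
      simp only [diffOuter, Nat.add_sub_cancel, sqrt_factorial_succ'] at *
      push_cast at *
      linear_combination a1 - Real.sqrt (l + 1) * r * a2
  · rcases l with _ | l
    · simp only [diffOuter, Nat.cast_zero, Real.sqrt_zero] at *
      linear_combination Real.sqrt (m + 1) * b1 +
        Real.sqrt (m ! * k !) * r ^ 0 * (kernelPoly Ω α n 0).coeff (m + 1) * hm
    · have b2 := kernelΓ_eq_coeff' hΩ hΩ1 hα hα1 (show n + l = k + m by omega)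
      have hl : Real.sqrt ((l : ℝ) + 1) * Real.sqrt ((l : ℝ) + 1) = l + 1 :=
        Real.mul_self_sqrt (by positivity)
      have ePoly2 : kernelPoly Ω α n (l + 1) = X * kernelPoly Ω α n l +
          C (parA Ω α) * ((1 - X) * kernelPoly Ω α n l) := by
        simp only [kernelPoly, binomPoly, map_sub, map_one]; ring
      have e3 := congrArg (fun p => p.coeff (m + 1)) ePoly2
      simp only [coeff_add, coeff_C_mul, coeff_X_mul] at e3
      simp only [diffOuter, Nat.add_sub_cancel, sqrt_factorial_succ'] at *
      push_cast at *
      linear_combination Real.sqrt (m + 1) * b1 - (l + 1) * r * b2 +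
        Real.sqrt (m ! * k !) * r ^ (l + 1) * (kernelPoly Ω α n (l + 1)).coeff (m + 1) * hm
        - Real.sqrt (n ! * l !) * r ^ (m + 1) * kernelΓ Ω Ω α m n k l * hl +
        Real.sqrt (m ! * k !) * r ^ (l + 1) * (l + 1) * e3

/-- As for `diffOuter_sq`, with the first binomial factor raised: `P_{k+1,m} - P_{k,m} = -b (1 - X)
P_{k,m}`. Here the dual representation gives the exact difference, and the first one the weights `n
+ 1 = k + (m - l)` and `k`. -/
theorem diffInner_sq (hΩ : 0 < Ω) (hΩ1 : Ω ≠ 1) (hα : 0 < α) (hα1 : α < 1) {m n k l : ℕ}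
    (h : n + l + 1 = k + m) : diffInner Ω α m n k l ^ 2 =
      (((m : ℝ) - l) * (kernelPoly Ω α k m).coeff l -
        k * parB Ω α * ((1 - X) * kernelPoly Ω α (k - 1) m).coeff l) *
      (-(parB Ω α * ((1 - X) * kernelPoly Ω α n l).coeff m)) := by
  have hr := ratio_ne_zero hΩ hΩ1
  set r := ratio Ω
  have hn : Real.sqrt ((n : ℝ) + 1) * Real.sqrt ((n : ℝ) + 1) = n + 1 :=
    Real.mul_self_sqrt (by positivity)
  have hR : (n : ℝ) + l + 1 = k + m := by exact_mod_cast h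
  have a1 := kernelΓ_eq_coeff hΩ hΩ1 hα hα1 (show n + 1 + l = k + m by omega)
  have b1 := kernelΓ_eq_coeff' hΩ hΩ1 hα hα1 (show n + 1 + l = k + m by omega)
  rw [sqrt_factorial_succ] at a1 b1
  refine mul_eq_of_dual (p := Real.sqrt ((m ! : ℝ) * k !) * r ^ l)
    (q := Real.sqrt ((n ! : ℝ) * l !) * r ^ m) (by positivity) (by positivity) ?_ ?_
  · rcases k with _ | k
    · simp only [diffInner, Nat.cast_zero, Real.sqrt_zero] at *
      linear_combination Real.sqrt (n + 1) * a1 +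
        Real.sqrt (n ! * l !) * r ^ m * (kernelPoly Ω α 0 m).coeff l * (hn + hR)
    · have a2 := kernelΓ_eq_coeff hΩ hΩ1 hα hα1 (show n + l = k + m by omega)
      have hk : Real.sqrt ((k : ℝ) + 1) * Real.sqrt ((k : ℝ) + 1) = k + 1 :=
        Real.mul_self_sqrt (by positivity)
      have ePoly2 : kernelPoly Ω α (k + 1) m + C (parB Ω α) * ((1 - X) * kernelPoly Ω α k m) =
          kernelPoly Ω α k m := by
        simp only [kernelPoly, binomPoly, map_sub, map_one]; ring
      have e3 := congrArg (fun p => p.coeff l) ePoly2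
      simp only [coeff_add, coeff_C_mul] at e3
      simp only [diffInner, Nat.add_sub_cancel, sqrt_factorial_succ'] at *
      push_cast at *
      linear_combination Real.sqrt (n + 1) * a1 - (k + 1) * a2 +
        Real.sqrt (n ! * l !) * r ^ m * (kernelPoly Ω α (k + 1) m).coeff l * (hn + hR)
        - Real.sqrt (m ! * k !) * r ^ l * kernelΓ Ω Ω α m n k l * hk +
        Real.sqrt (n ! * l !) * r ^ m * (k + 1) * e3
  · have ePoly : kernelPoly Ω α (n + 1) l + C (parB Ω α) * ((1 - X) * kernelPoly Ω α n l) =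
          kernelPoly Ω α n l := by
        simp only [kernelPoly, binomPoly, map_sub, map_one]; ring
    have e3 := congrArg (fun p => p.coeff m) ePoly
    simp only [coeff_add, coeff_C_mul] at e3
    have b1' : Real.sqrt ((n ! : ℝ) * l !) * r ^ m *
        (Real.sqrt (n + 1) * kernelΓ Ω Ω α m (n + 1) k l) =
        Real.sqrt ((m ! : ℝ) * k !) * r ^ l * (kernelPoly Ω α (n + 1) l).coeff m := by
      linear_combination b1
    rcases k with _ | k
    -- For `k = 0` the subtracted kernel entry is missing; the coefficient that would replace it
    -- lies beyond the degree, since `m = n + l + 1`.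
    · have e4 : (kernelPoly Ω α n l).coeff m = 0 :=
        coeff_eq_zero_of_natDegree_lt (lt_of_le_of_lt (natDegree_binomPoly_le _ _ n l) (by omega))
      simp only [diffInner, Nat.cast_zero, Real.sqrt_zero] at *
      linear_combination b1' + Real.sqrt (m ! * 0 !) * r ^ l * (e3 + e4)
    · have b2 := kernelΓ_eq_coeff' hΩ hΩ1 hα hα1 (show n + l = k + m by omega)
      simp only [diffInner, Nat.add_sub_cancel, sqrt_factorial_succ'] at *
      push_cast at *
      linear_combination b1' - Real.sqrt (k + 1) * b2 +
        Real.sqrt (k + 1) * Real.sqrt (m ! * k !) * r ^ l * e3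

/-! ### Lower bounds for the deviation rates. -/

theorem tiltRate_le_add {V : ℝ} (hV : 0 < V) (t t' : ℝ) :
    tiltRate V t ≤ tiltRate V t' + |t - t'| := by
  have h1 : |t| - |t'| ≤ |t - t'| := abs_sub_abs_le_abs_sub t t'
  have h2 : |t'| - |t| ≤ |t - t'| := by rw [abs_sub_comm]; exact abs_sub_abs_le_abs_sub t' t
  have h0 := abs_nonneg (t - t')
  set d := |t - t'|
  unfold tiltRate
  rw [← sq_abs t, ← sq_abs t']
  have hx := abs_nonneg t
  have hy := abs_nonneg t'
  set x := |t|
  set y := |t'|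
  rw [div_add' _ _ _ (by positivity), div_le_div_iff₀ (by positivity) (by positivity)]
  have h3 : (x - y) * (2 * V * (x + y) + x * y) ≤ d * (2 * V * (x + y) + x * y) :=
    mul_le_mul_of_nonneg_right h1 (by positivity)
  have h4 : 0 ≤ d * V ^ 2 := by positivity
  nlinarith

/-- The linear tail of the rate, used where the deviations are not small against the variance. -/
theorem le_tiltRate {V ε : ℝ} (hV : 0 < V) (hε0 : 0 ≤ ε) (hε1 : ε ≤ 1) (t : ℝ) :
    ε * |t| - 2 * ε ^ 2 * V ≤ tiltRate V t := by
  have hx := abs_nonneg t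
  unfold tiltRate
  rw [← sq_abs t]
  set x := |t|
  rw [le_div_iff₀ (by positivity)]
  have h1 : 0 ≤ (1 - ε) * (x - ε * V) ^ 2 := mul_nonneg (by linarith) (sq_nonneg _)
  have h2 : 0 ≤ ε ^ 2 * V ^ 2 * (3 + ε) := by positivity
  nlinarith

theorem sq_div_le_tiltRate {V S t : ℝ} (hV : 0 < V) (hS : 2 * V + |t| ≤ S) :
    t ^ 2 / S ≤ tiltRate V t := by
  have hx := abs_nonneg t
  unfold tiltRate
  gcongr

theorem parA_nonneg (hC : 0 < constC Ω) (hα : 0 < α) : 0 ≤ parA Ω α := by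
  unfold parA; positivity

theorem parB_nonneg (hC : 0 < constC Ω) (hα : 0 < α) : 0 ≤ parB Ω α := by
  unfold parB; positivity

theorem parA_le_one (hC : 0 < constC Ω) (hα : 0 < α) (hα1 : α < 1) : parA Ω α ≤ 1 := by
  unfold parA; rw [div_le_one (by positivity)]; linarith

theorem parA_le (hC : 0 < constC Ω) (hα : 0 < α) : parA Ω α ≤ (1 + constC Ω) * α := by
  unfold parA
  apply div_le_self (by positivity)
  have := mul_pos hC hα; linarith

theorem parB_le (hC : 0 < constC Ω) (hα : 0 < α) : parB Ω α ≤ constC Ω * α := by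
  unfold parB
  apply div_le_self (by positivity)
  have := mul_pos hC hα; linarith

theorem le_parA (hC : 0 < constC Ω) (hα : 0 < α) (hα1 : α < 1) : α ≤ parA Ω α := by
  unfold parA; rw [le_div_iff₀ (by positivity)]
  nlinarith [mul_pos hC hα]

theorem le_parB (hC : 0 < constC Ω) (hα : 0 < α) (hα1 : α < 1) :
    constC Ω / (1 + constC Ω) * α ≤ parB Ω α := by
  unfold parB
  rw [div_mul_eq_mul_div]
  gcongr
  nlinarith [mul_pos hC hα]

theorem le_one_sub_parB (hC : 0 < constC Ω) (hα : 0 < α) (hα1 : α < 1) :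
    1 / (1 + constC Ω) ≤ 1 - parB Ω α := by
  have hCa := mul_pos hC hα
  have : 1 - parB Ω α = 1 / (1 + constC Ω * α) := by
    unfold parB; field_simp; ring
  rw [this]
  gcongr
  nlinarith

theorem constC_mul_parA : constC Ω * parA Ω α = (1 + constC Ω) * parB Ω α := by
  unfold parA parB; ring

/-- Deviation of the coefficient index from the mean of the tilted law. -/
def dev (Ω α : ℝ) (N L j : ℕ) : ℝ := (j : ℝ) - L - parB Ω α * N + parA Ω α * L

/-- All coefficients occurring in a commutator have indices within one unit of a base point `(N₀,
L₀, j₀)`. Such shifts change the rate by at most 3 and `1 + bN` by at most a factor 2, which `2 *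
exp 1` absorbs, so every neighbour obeys the bound of the base point. -/
theorem exists_kernelPoly_coeff_le (hC : 0 < constC Ω) :
    ∃ K : ℝ, 0 < K ∧ ∀ (α V : ℝ) (N L j N₀ L₀ j₀ : ℕ), 0 < α → α < 1 →
      1 + parB Ω α * N₀ + parA Ω α * L₀ ≤ V → N ≤ N₀ → N₀ ≤ N + 1 → L ≤ L₀ → L₀ ≤ L + 1 →
      j₀ ≤ j → j ≤ j₀ + 1 →
      |(kernelPoly Ω α N L).coeff j| ≤ K / Real.sqrt (1 + parB Ω α * N₀) *
          Real.exp (-(tiltRate V (dev Ω α N₀ L₀ j₀)) / 4) ∧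
      |((1 - X) * kernelPoly Ω α N L).coeff j| ≤ K / (1 + parB Ω α * N₀) *
          Real.exp (-(tiltRate V (dev Ω α N₀ L₀ j₀)) / 4) := by
  obtain ⟨K, hK, H⟩ := exists_binomPoly_coeff_le (κ := 1 / (1 + constC Ω)) (by positivity)
  refine ⟨K * 2 * Real.exp 1, by positivity, ?_⟩
  intro α V N L j N₀ L₀ j₀ hα hα1 hV hN hN' hL hL' hj hj'
  have ha := parA_nonneg (Ω := Ω) hC hα
  have ha1 := parA_le_one (Ω := Ω) hC hα hα1
  have hb := parB_nonneg (Ω := Ω) hC hα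
  have hb1 := le_one_sub_parB (Ω := Ω) hC hα hα1
  have hb2 : parB Ω α ≤ 1 := by
    have : 0 < 1 / (1 + constC Ω) := by positivity
    linarith
  have rN : (N : ℝ) ≤ N₀ := by exact_mod_cast hN
  have rN' : (N₀ : ℝ) ≤ N + 1 := by exact_mod_cast hN'
  have rL : (L : ℝ) ≤ L₀ := by exact_mod_cast hL
  have rL' : (L₀ : ℝ) ≤ L + 1 := by exact_mod_cast hL'
  have rj : (j₀ : ℝ) ≤ j := by exact_mod_cast hj
  have rj' : (j : ℝ) ≤ j₀ + 1 := by exact_mod_cast hj'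
  have hbN := mul_le_mul_of_nonneg_left rN hb
  have hbN' := mul_le_mul_of_nonneg_left rN' hb
  have haL := mul_le_mul_of_nonneg_left rL ha
  have hbN0 : 0 ≤ parB Ω α * N := by positivity
  have haL0 : 0 ≤ parA Ω α * L := by positivity
  have hV0 : 0 < V := by linarith
  obtain ⟨h1, h2⟩ := H (parA Ω α) (parB Ω α) V N L j ha ha1 hb hb1 (by linarith)
  have hdev : |dev Ω α N₀ L₀ j₀ - dev Ω α N L j| ≤ 3 := by
    unfold dev
    have hx : 0 ≤ (1 - parA Ω α) * (L₀ - L) := mul_nonneg (by linarith) (by linarith)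
    have hx' : (1 - parA Ω α) * (L₀ - L) ≤ 1 := mul_le_one₀ (by linarith) (by linarith) (by linarith)
    rw [abs_le]
    constructor <;> nlinarith
  have hw := tiltRate_le_add hV0 (dev Ω α N₀ L₀ j₀) (dev Ω α N L j)
  have hw0 : 0 ≤ tiltRate V (dev Ω α N L j) :=
    div_nonneg (sq_nonneg _) (by have := abs_nonneg (dev Ω α N L j); linarith)
  have hdevdef : (j : ℝ) - L - parB Ω α * N + parA Ω α * L = dev Ω α N L j := rfl
  rw [hdevdef] at h1 h2
  set w := tiltRate V (dev Ω α N L j)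
  set w₀ := tiltRate V (dev Ω α N₀ L₀ j₀)
  have hexp : Real.exp (-w / 4) ≤ Real.exp 1 * Real.exp (-w₀ / 4) := by
    rw [← Real.exp_add]; apply Real.exp_le_exp.2; linarith
  have hexp' : Real.exp (-w / 2) ≤ Real.exp (-w / 4) := by
    apply Real.exp_le_exp.2; linarith
  have hD0 : 0 < 1 + parB Ω α * N := by linarith
  have hD0' : 0 < 1 + parB Ω α * N₀ := by linarith
  have hD : 1 + parB Ω α * N₀ ≤ 2 * (1 + parB Ω α * N) := by linarith
  have hs : Real.sqrt (1 + parB Ω α * N₀) ≤ 2 * Real.sqrt (1 + parB Ω α * N) := by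
    apply Real.sqrt_le_iff.2 ⟨by positivity, ?_⟩
    rw [mul_pow, Real.sq_sqrt hD0.le]; linarith
  have hs0 := Real.sqrt_pos.2 hD0
  have hs0' := Real.sqrt_pos.2 hD0'
  constructor
  · refine h1.trans ?_
    calc _ ≤ K * 2 / Real.sqrt (1 + parB Ω α * N₀) * (Real.exp 1 * Real.exp (-w₀ / 4)) := by
          refine mul_le_mul ?_ (hexp'.trans hexp) (Real.exp_pos _).le (by positivity)
          rw [div_le_div_iff₀ hs0 hs0', mul_assoc]
          gcongr
      _ = _ := by ring
  · refine h2.trans ?_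
    calc _ ≤ K * 2 / (1 + parB Ω α * N₀) * (Real.exp 1 * Real.exp (-w₀ / 4)) := by
          refine mul_le_mul ?_ hexp (Real.exp_pos _).le (by positivity)
          rw [div_le_div_iff₀ hD0 hD0', mul_assoc]
          gcongr
      _ = _ := by ring

/-- Common upper bound for the variance proxies of both laws. -/
def varBound (Ω α : ℝ) (k : ℕ) : ℝ := (2 + 2 * constC Ω) * (1 + α * k)

/-- Sum of the two large deviation rates controlling the kernel. -/
def totalRate (Ω α : ℝ) (m n k l : ℕ) : ℝ :=
  tiltRate (varBound Ω α k) (dev Ω α k m l) + tiltRate (varBound Ω α k) (dev Ω α n l m)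

theorem le_varBound (hC : 0 < constC Ω) (hα : 0 < α) (hα1 : α < 1) {N L k : ℕ} (hN : N ≤ k + 1)
    (hL : L ≤ k + 1) : 1 + parB Ω α * N + parA Ω α * L ≤ varBound Ω α k := by
  have rN : (N : ℝ) ≤ k + 1 := by exact_mod_cast hN
  have rL : (L : ℝ) ≤ k + 1 := by exact_mod_cast hL
  have h1 : parB Ω α * N ≤ constC Ω * α * (k + 1) :=
    mul_le_mul (parB_le hC hα) rN (by positivity) (by positivity)
  have h2 : parA Ω α * L ≤ (1 + constC Ω) * α * (k + 1) :=
    mul_le_mul (parA_le hC hα) rL (by positivity) (by positivity)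
  unfold varBound
  have hk : 0 ≤ α * k := by positivity
  nlinarith [mul_nonneg hC.le hk, mul_pos hC (sub_pos.2 hα1)]

theorem add_add_one_sq_le (x y : ℝ) : (x + y + 1) ^ 2 ≤ 3 * (x ^ 2 + y ^ 2 + 1) := by
  nlinarith [sq_nonneg (x - y), sq_nonneg (x - 1), sq_nonneg (y - 1)]

/-- For `αk ≥ 1` the weights compare directly because `a ≥ α`; for `αk ≤ 1` the left side is at most
`α(1+k) ≤ 2`. -/
theorem weighted_sq_le {a k d : ℝ} (hα : 0 < α) (hα1 : α < 1) (haα : α ≤ a) (rk : 0 ≤ k)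
    (hd : d ^ 2 ≤ (1 + k) ^ 2) :
    α / (1 + k) * d ^ 2 ≤ 2 * (a ^ 2 * d ^ 2 / (1 + α * k)) + 2 := by
  have hU0 : 0 < 1 + α * k := by positivity
  rcases le_total 1 (α * k) with h3 | h3
  · have h4 : α / (1 + k) ≤ 2 * (a ^ 2 / (1 + α * k)) := by
      rw [mul_div_assoc', div_le_div_iff₀ (by positivity) hU0]
      have h5 : α ^ 2 ≤ a ^ 2 := pow_le_pow_left₀ hα.le haα 2
      have h6 : α * (1 + α * k) ≤ 2 * α ^ 2 * (1 + k) := by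
        nlinarith [mul_le_mul_of_nonneg_left h3 hα.le]
      have h7 := mul_le_mul_of_nonneg_right h5 (show (0 : ℝ) ≤ 1 + k by positivity)
      linarith
    have := mul_le_mul_of_nonneg_right h4 (sq_nonneg d)
    calc _ ≤ _ := this
      _ = 2 * (a ^ 2 * d ^ 2 / (1 + α * k)) := by ring
      _ ≤ _ := by linarith
  · have h5 : α / (1 + k) * d ^ 2 ≤ α / (1 + k) * (1 + k) ^ 2 := by gcongr
    have h6 : α / (1 + k) * (1 + k) ^ 2 = α * (1 + k) := by field_simp
    have h7 : 0 ≤ 2 * (a ^ 2 * d ^ 2 / (1 + α * k)) := by positivity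
    linarith

-- The deviations `t1`, `t2` of the two laws satisfy two linear relations: `(2-a-b)p = t1 - t2 -
-- be`, and, with `d = h - k/(1+C)`, `ad = -t2 + (a-b)e - (1-b)p`, where `e = n + l - k - m` is -1,
-- 0 or 1. Since `2 - a - b ≥ κ`, the deviations bound `p`, and then `ad`. For `2p ≤ αk` they are at
-- most of the order of `V`, so the rates are quadratic; otherwise `V` is of order at most `1 + p`
-- and the linear tail wins.
set_option maxHeartbeats 1000000 in
theorem exists_le_totalRate (hC : 0 < constC Ω) :
    ∃ c R : ℝ, 0 < c ∧ ∀ (α : ℝ) (m n k l : ℕ), 0 < α → α < 1 → m ≤ n → m ≤ l →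
      n + l ≤ k + m + 1 → k + m ≤ n + l + 1 →
      (2 * ((l : ℝ) - m) ≤ α * k →
        c * (((l : ℝ) - m) ^ 2 / (1 + k * α) +
          α / (1 + k) * ((n : ℝ) - m - k / (1 + constC Ω)) ^ 2) - R ≤ totalRate Ω α m n k l) ∧
      (α * k < 2 * ((l : ℝ) - m) →
        c * (k * α + ((l : ℝ) - m)) - R ≤ totalRate Ω α m n k l) := by
  set κ : ℝ := 1 / (1 + constC Ω) with hκ
  have hκ0 : 0 < κ := by positivity
  have hκ1 : κ ≤ 1 := by rw [hκ, div_le_one (by positivity)]; linarith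
  have hCκ : 1 + constC Ω = 1 / κ := by rw [hκ]; field_simp
  have hκC : κ * (1 + constC Ω) = 1 := by rw [hκ]; field_simp
  refine ⟨κ ^ 3 / 384, 2, by positivity, ?_⟩
  intro α m n k l hα hα1 hmn hml h1 h2
  have hxV : varBound Ω α k = 2 / κ * (1 + α * k) := by
    unfold varBound; linear_combination (2 * (1 + α * k)) * hCκ
  have ha := parA_nonneg (Ω := Ω) hC hα
  have ha1 := parA_le_one (Ω := Ω) hC hα hα1
  have hb := parB_nonneg (Ω := Ω) hC hα
  have hb1 : κ ≤ 1 - parB Ω α := le_one_sub_parB hC hα hα1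
  have hab : constC Ω * parA Ω α = (1 + constC Ω) * parB Ω α := constC_mul_parA
  have haα := le_parA hC hα hα1
  have hvar1 := le_varBound hC hα hα1 (N := k) (L := m) (k := k) (by omega) (by omega)
  have hvar2 := le_varBound hC hα hα1 (N := n) (L := l) (k := k) (by omega) (by omega)
  have rmn : (m : ℝ) ≤ n := by exact_mod_cast hmn
  have rml : (m : ℝ) ≤ l := by exact_mod_cast hml
  have r1 : (n : ℝ) + l ≤ k + m + 1 := by exact_mod_cast h1
  have r2 : (k : ℝ) + m ≤ n + l + 1 := by exact_mod_cast h2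
  have rm : (0 : ℝ) ≤ m := by positivity
  have rk : (0 : ℝ) ≤ k := by positivity
  have hαk : 0 ≤ α * k := by positivity
  unfold totalRate
  have e1 : dev Ω α k m l = (l : ℝ) - m - parB Ω α * k + parA Ω α * m := rfl
  have e2 : dev Ω α n l m = (m : ℝ) - l - parB Ω α * n + parA Ω α * l := rfl
  set t1 := dev Ω α k m l
  set t2 := dev Ω α n l m
  set V := varBound Ω α k
  set a := parA Ω α
  set b := parB Ω α
  clear_value t1 t2 V a b κ
  have hV0 : 0 < V := by rw [hxV]; positivity
  obtain ⟨p, hp⟩ : ∃ p : ℝ, p = l - m := ⟨_, rfl⟩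
  obtain ⟨e, he⟩ : ∃ e : ℝ, e = n + l - k - m := ⟨_, rfl⟩
  have hp0 : 0 ≤ p := by linarith
  have he1 : |e| ≤ 1 := abs_le.2 ⟨by linarith, by linarith⟩
  have hba : b ≤ a := by nlinarith
  have ediff : (2 - a - b) * p = t1 - t2 - b * e := by rw [e1, e2, he, hp]; ring
  have hbe : |b * e| ≤ 1 := by
    rw [abs_mul, abs_of_nonneg hb]
    exact mul_le_one₀ (by linarith) (abs_nonneg _) he1
  have hκp : κ * p ≤ |t1| + |t2| + 1 := by
    have h3 : κ * p ≤ (2 - a - b) * p := mul_le_mul_of_nonneg_right (by linarith) hp0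
    have := neg_abs_le (b * e)
    have := le_abs_self t1
    have := neg_abs_le t2
    linarith
  rw [← hp]
  constructor
  · intro hA
    set U := 1 + α * k with hU
    have hU1 : 1 ≤ U := by linarith
    have hUc : 1 + (k : ℝ) * α = U := by rw [hU]; ring
    have x1 : 0 ≤ b * k := by positivity
    have x2 : 0 ≤ a * m := by positivity
    have x1' : 0 ≤ b * n := by positivity
    have x2' : 0 ≤ a * l := by positivity
    have hUV : U ≤ V := by
      rw [hxV, hU]
      apply le_mul_of_one_le_left (by linarith)
      rw [le_div_iff₀ hκ0]; linarith
    have hS1 : t1 ^ 2 / (4 * V) ≤ tiltRate V t1 := by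
      apply sq_div_le_tiltRate hV0
      have : |t1| ≤ 2 * V := by
        rw [abs_le, e1]; constructor <;> linarith
      linarith
    have hS2 : t2 ^ 2 / (4 * V) ≤ tiltRate V t2 := by
      apply sq_div_le_tiltRate hV0
      have : |t2| ≤ 2 * V := by
        rw [abs_le, e2]; constructor <;> linarith
      linarith
    have hδ1 : ∃ d : ℝ, d = (n : ℝ) - m - k / (1 + constC Ω) := ⟨_, rfl⟩
    obtain ⟨d, hd⟩ := hδ1
    rw [← hd, hUc]
    have hdk : d = n - m - κ * k := by rw [hd, hκ]; ring
    have had : |a * d| ≤ |t2| + p + 1 := by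
      have hbκ : b = a - κ * a := by
        have := congrArg (fun x => κ * x) hab
        linear_combination (-1 : ℝ) * this + (a - b) * hκC
      have h3 : a * d = -t2 + (a - b) * e - (1 - b) * p := by
        rw [e2, hdk, he, hp]; linear_combination (-(k : ℝ)) * hbκ
      have h4 : |(a - b) * e| ≤ 1 := by
        rw [abs_mul, abs_of_nonneg (by linarith)]
        exact mul_le_one₀ (by linarith) (abs_nonneg _) he1
      have h5 : |(1 - b) * p| ≤ p := by
        rw [abs_of_nonneg (mul_nonneg (by linarith) hp0)]
        exact mul_le_of_le_one_left hp0 (by linarith)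
      rw [h3]
      calc _ ≤ |-t2 + (a - b) * e| + |(1 - b) * p| := abs_sub _ _
        _ ≤ |-t2| + |(a - b) * e| + |(1 - b) * p| := by gcongr; exact abs_add_le _ _
        _ ≤ _ := by rw [abs_neg]; linarith
    have hsq1 : κ ^ 2 * p ^ 2 ≤ 3 * (t1 ^ 2 + t2 ^ 2 + 1) := by
      have : (κ * p) ^ 2 ≤ (|t1| + |t2| + 1) ^ 2 := pow_le_pow_left₀ (by positivity) hκp 2
      have h4 := add_add_one_sq_le |t1| |t2|
      rw [sq_abs, sq_abs] at h4
      linarith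
    have hsq2 : a ^ 2 * d ^ 2 ≤ 3 * (t2 ^ 2 + p ^ 2 + 1) := by
      have : |a * d| ^ 2 ≤ (|t2| + p + 1) ^ 2 := pow_le_pow_left₀ (abs_nonneg _) had 2
      have h4 := add_add_one_sq_le |t2| p
      rw [sq_abs] at this h4
      linarith
    have hsq3 : κ ^ 2 * (a ^ 2 * d ^ 2) ≤ 12 * (t1 ^ 2 + t2 ^ 2 + 1) := by
      have h3 := mul_le_mul_of_nonneg_left hsq2 (sq_nonneg κ)
      have h4 : κ ^ 2 ≤ 1 := pow_le_one₀ hκ0.le hκ1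
      have h5 : κ ^ 2 * (t2 ^ 2 + 1) ≤ 1 * (t2 ^ 2 + 1) :=
        mul_le_mul_of_nonneg_right h4 (by positivity)
      linarith [sq_nonneg t1]
    have hsum : κ ^ 2 * p ^ 2 / 6 + κ ^ 2 * (a ^ 2 * d ^ 2) / 24 - 1 ≤ t1 ^ 2 + t2 ^ 2 := by
      linarith
    have hκk : κ * k ≤ k := mul_le_of_le_one_left rk hκ1
    have hκk0 : 0 ≤ κ * k := by positivity
    have hz : α / (1 + k) * d ^ 2 ≤ 2 * (a ^ 2 * d ^ 2 / U) + 2 := by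
      rw [hU]
      exact weighted_sq_le hα hα1 haα rk
        (sq_le_sq' (by rw [hdk]; linarith) (by rw [hdk]; linarith))
    have hmain : κ ^ 3 / 192 * (p ^ 2 / U + a ^ 2 * d ^ 2 / U) - 1 ≤
        (t1 ^ 2 + t2 ^ 2) / (4 * V) := by
      have h3 : (t1 ^ 2 + t2 ^ 2) / (4 * V) = κ * (t1 ^ 2 + t2 ^ 2) / (8 * U) := by
        rw [hxV]; field_simp; ring
      rw [h3, le_div_iff₀ (by positivity)]
      have h4 : (κ ^ 3 / 192 * (p ^ 2 / U + a ^ 2 * d ^ 2 / U) - 1) * (8 * U) =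
          κ ^ 3 / 24 * (p ^ 2 + a ^ 2 * d ^ 2) - 8 * U := by field_simp; ring
      rw [h4]
      have h5 := mul_le_mul_of_nonneg_left hsum hκ0.le
      have h6 : 0 ≤ κ ^ 3 * p ^ 2 := by positivity
      linarith
    have hsplit : (t1 ^ 2 + t2 ^ 2) / (4 * V) = t1 ^ 2 / (4 * V) + t2 ^ 2 / (4 * V) :=
      add_div _ _ _
    have x4 : κ ^ 3 ≤ 1 := pow_le_one₀ hκ0.le hκ1
    have hz' := mul_le_mul_of_nonneg_left hz (show 0 ≤ κ ^ 3 / 384 by positivity)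
    have hp2 : 0 ≤ κ ^ 3 * (p ^ 2 / U) := by positivity
    linarith
  · intro hB
    -- With `ε = κ²/32` the loss `4ε²V` costs, up to constants, half of the linear gain `εκp`; the
    -- rest covers `p` and also `αk < 2p`.
    have hε1 : κ ^ 2 / 32 ≤ 1 := by nlinarith
    have w1 := le_tiltRate hV0 (by positivity) hε1 t1
    have w2 := le_tiltRate hV0 (by positivity) hε1 t2
    have hVp : κ * V ≤ 2 * (1 + 2 * p) := by
      rw [hxV]
      have : κ * (2 / κ * (1 + α * k)) = 2 * (1 + α * k) := by field_simp
      rw [this]; linarith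
    have x1 : (κ ^ 2 / 32) ^ 2 * V ≤ κ ^ 3 / 1024 * (2 * (1 + 2 * p)) := by
      have := mul_le_mul_of_nonneg_left hVp (show 0 ≤ κ ^ 3 / 1024 by positivity)
      linarith
    have x2 : κ ^ 2 / 32 * (κ * p) ≤ κ ^ 2 / 32 * (|t1| + |t2| + 1) :=
      mul_le_mul_of_nonneg_left hκp (by positivity)
    have x3 : κ ^ 3 * (α * k) ≤ κ ^ 3 * (2 * p) := mul_le_mul_of_nonneg_left hB.le (by positivity)
    have x4 : κ ^ 3 ≤ 1 := pow_le_one₀ hκ0.le hκ1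
    have x5 : 0 ≤ κ ^ 3 * p := by positivity
    linarith

/-! ### From rates to the decay function. -/

theorem add_le_mul_exp {A c x : ℝ} (hA : 1 ≤ A) (hc : 0 < c) (hx : 0 ≤ x) :
    A + x ≤ (A + 1 / c) * Real.exp (c * x) := by
  have h1 := Real.add_one_le_exp (c * x)
  have h2 : (A + 1 / c) * (c * x + 1) ≤ (A + 1 / c) * Real.exp (c * x) := by gcongr
  have h3 : (A + 1 / c) * (c * x + 1) = A * c * x + A + x + 1 / c := by field_simp; ring
  have : 0 ≤ A * c * x := by positivity
  have : 0 < 1 / c := by positivity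
  linarith

theorem decay_nonneg {c s k h p : ℝ} : 0 ≤ decay Ω c s k h p := by
  unfold decay; positivity

/-- Here `x` stands for a normalized square of a kernel entry or of a difference, whence `decay ^
2`. Factors growing with `p` are absorbed by part of the exponent, and `1/(1+αk)` is comparable with
the square of `1/(1+√(αk))`. -/
theorem exists_le_decay_sq (hC : 0 < constC Ω) :
    ∃ K c : ℝ, 0 < K ∧ 0 < c ∧ ∀ (α : ℝ) (m n k l : ℕ), 0 < α → α < 1 → m ≤ n → m ≤ l →
      n + l ≤ k + m + 1 → k + m ≤ n + l + 1 → ∀ x : ℝ,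
      (α * k < 2 * ((l : ℝ) - m) →
        x ≤ (1 + ((l : ℝ) - m)) * Real.exp (-(totalRate Ω α m n k l) / 4)) →
      (2 * ((l : ℝ) - m) ≤ α * k →
        x ≤ 1 / (1 + α * k) * (1 + (1 + ((l : ℝ) - m)) / Real.sqrt (1 + α * k)) *
          Real.exp (-(totalRate Ω α m n k l) / 4)) →
      x ≤ K * decay Ω c α k ((n : ℝ) - m) ((l : ℝ) - m) ^ 2 := by
  obtain ⟨c, R, hc, H⟩ := exists_le_totalRate hC
  -- The rate enters divided by 4; half of the resulting `c/4` pays for the polynomial factor, and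
  -- the square in `decay ^ 2` halves the remaining `c/8`.
  refine ⟨2 * Real.exp (R / 4) * (3 + 1 / (c / 8)), c / 16, by positivity, by positivity, ?_⟩
  intro α m n k l hα hα1 hmn hml h1 h2 x hB hA
  obtain ⟨HA, HB⟩ := H α m n k l hα hα1 hmn hml h1 h2
  have rml : (m : ℝ) ≤ l := by exact_mod_cast hml
  obtain ⟨p, hp⟩ : ∃ p : ℝ, p = l - m := ⟨_, rfl⟩
  have hp0 : 0 ≤ p := by linarith
  rw [← hp] at HA HB hA hB ⊢
  set w := totalRate Ω α m n k l
  set h : ℝ := (n : ℝ) - m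
  clear_value w h
  have hαk : 0 ≤ α * k := by positivity
  have hkα : (k : ℝ) * α = α * k := mul_comm _ _
  unfold decay
  rw [hkα] at HA HB ⊢
  set D1 := Real.exp (-(c / 16 * p ^ 2 / (1 + α * k)) - c / 16 * α / (1 + k) *
    (h - k / (1 + constC Ω)) ^ 2) / (1 + Real.sqrt (α * k)) with hD1
  set D2 := Real.exp (-(c / 16 * k * α) - c / 16 * p) with hD2
  have hD10 : 0 ≤ D1 := by positivity
  have hD20 : 0 ≤ D2 := by positivity
  rcases le_or_gt (2 * p) (α * k) with hcase | hcase
  · have hx := hA hcase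
    have hw := HA hcase
    set U := 1 + α * k with hU
    have hU1 : 1 ≤ U := by linarith
    have hsU : 0 < Real.sqrt U := Real.sqrt_pos.2 (by linarith)
    have hsU1 : 1 ≤ Real.sqrt U := Real.one_le_sqrt.2 hU1
    set y := p ^ 2 / U with hy
    set z := α / (1 + k) * (h - k / (1 + constC Ω)) ^ 2 with hz
    have hy0 : 0 ≤ y := by positivity
    have hz0 : 0 ≤ z := by positivity
    have e1 : 1 + (1 + p) / Real.sqrt U ≤ 3 + y := by
      have h3 : (p / Real.sqrt U) ^ 2 = y := by
        rw [div_pow, Real.sq_sqrt (by linarith)]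
      have h4 : 1 / Real.sqrt U ≤ 1 := by rw [div_le_one hsU]; exact hsU1
      have h5 : p / Real.sqrt U ≤ 1 + y := by
        rw [← h3]; nlinarith [sq_nonneg (p / Real.sqrt U - 1)]
      rw [add_div]; linarith
    have e2 := add_le_mul_exp (A := 3) (c := c / 8) (x := y) (by norm_num) (by positivity) hy0
    have e3 : Real.exp (-w / 4) ≤ Real.exp (R / 4) * Real.exp (-(c / 4) * (y + z)) := by
      rw [← Real.exp_add]; apply Real.exp_le_exp.2; linarith
    have e4 : Real.exp (c / 8 * y) * Real.exp (-(c / 4) * (y + z)) ≤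
        Real.exp (-(c / 8) * (y + z)) := by
      rw [← Real.exp_add]; apply Real.exp_le_exp.2
      have := mul_nonneg hc.le hz0
      linarith
    have e5 : D1 ^ 2 = Real.exp (-(c / 8) * (y + z)) / (1 + Real.sqrt (α * k)) ^ 2 := by
      rw [hD1, div_pow, ← Real.exp_nat_mul]
      congr 2; rw [hy, hz]; push_cast; ring
    have e6 : 1 / U ≤ 2 / (1 + Real.sqrt (α * k)) ^ 2 := by
      rw [div_le_div_iff₀ (by positivity) (by positivity)]
      have := Real.sq_sqrt hαk
      nlinarith [sq_nonneg (Real.sqrt (α * k) - 1)]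
    calc x ≤ 1 / U * (1 + (1 + p) / Real.sqrt U) * Real.exp (-w / 4) := hx
      _ ≤ (2 / (1 + Real.sqrt (α * k)) ^ 2) * ((3 + 1 / (c / 8)) * Real.exp (c / 8 * y)) *
          (Real.exp (R / 4) * Real.exp (-(c / 4) * (y + z))) := by
          gcongr
          exact e1.trans e2
      _ = 2 * Real.exp (R / 4) * (3 + 1 / (c / 8)) * ((Real.exp (c / 8 * y) *
          Real.exp (-(c / 4) * (y + z))) / (1 + Real.sqrt (α * k)) ^ 2) := by ring
      _ ≤ 2 * Real.exp (R / 4) * (3 + 1 / (c / 8)) * D1 ^ 2 := by rw [e5]; gcongr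
      _ ≤ 2 * Real.exp (R / 4) * (3 + 1 / (c / 8)) * (D1 + D2) ^ 2 := by gcongr; linarith
  · have hx := hB hcase
    have hw := HB hcase
    have e2 := add_le_mul_exp (A := 1) (c := c / 8) (x := p) le_rfl (by positivity) hp0
    have e3 : Real.exp (-w / 4) ≤ Real.exp (R / 4) * Real.exp (-(c / 4) * (α * k + p)) := by
      rw [← Real.exp_add]; apply Real.exp_le_exp.2; linarith
    have e4 : Real.exp (c / 8 * p) * Real.exp (-(c / 4) * (α * k + p)) ≤ D2 ^ 2 := by
      rw [hD2, ← Real.exp_nat_mul, ← Real.exp_add]; apply Real.exp_le_exp.2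
      have := mul_nonneg hc.le hαk
      push_cast
      linarith
    have hc8 : 0 < 1 / (c / 8) := by positivity
    calc x ≤ (1 + p) * Real.exp (-w / 4) := hx
      _ ≤ ((1 + 1 / (c / 8)) * Real.exp (c / 8 * p)) *
          (Real.exp (R / 4) * Real.exp (-(c / 4) * (α * k + p))) := by gcongr
      _ = Real.exp (R / 4) * (1 + 1 / (c / 8)) * (Real.exp (c / 8 * p) *
          Real.exp (-(c / 4) * (α * k + p))) := by ring
      _ ≤ (2 * Real.exp (R / 4)) * (3 + 1 / (c / 8)) * (D1 + D2) ^ 2 := by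
          have h3 : D2 ^ 2 ≤ (D1 + D2) ^ 2 := by gcongr; linarith
          have h4 : Real.exp (R / 4) ≤ 2 * Real.exp (R / 4) := by
            linarith [Real.exp_pos (R / 4)]
          have h5 : 1 + 1 / (c / 8) ≤ 3 + 1 / (c / 8) := by linarith
          have h6 := e4.trans h3
          gcongr

/-- In the central regime both variances are comparable with `1 + α k`. -/
theorem exists_mul_le_variance (hC : 0 < constC Ω) :
    ∃ η : ℝ, 0 < η ∧ η ≤ 1 ∧ ∀ (α : ℝ) (m n k l : ℕ), 0 < α → α < 1 →
      k + m ≤ n + l + 1 → 2 * ((l : ℝ) - m) ≤ α * k →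
      η * (1 + α * k) ≤ 1 + parB Ω α * k ∧ η * (1 + α * k) ≤ 1 + parB Ω α * n := by
  set κ : ℝ := 1 / (1 + constC Ω) with hκ
  have hκ0 : 0 < κ := by positivity
  have hκ1 : κ ≤ 1 := by rw [hκ, div_le_one (by positivity)]; linarith
  have hCκ : constC Ω * κ = 1 - κ := by rw [hκ]; field_simp; ring
  have hCκ0 : 0 < constC Ω * κ := by positivity
  have hη1 : constC Ω * κ * κ ≤ κ := mul_le_of_le_one_left hκ0.le (by linarith)
  have hη2 : constC Ω * κ * κ ≤ constC Ω * κ := mul_le_of_le_one_right hCκ0.le hκ1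
  refine ⟨constC Ω * κ * κ / 2, by positivity, by linarith, ?_⟩
  intro α m n k l hα hα1 h hcase
  have hb := parB_nonneg (Ω := Ω) hC hα
  have hb1 : κ ≤ 1 - parB Ω α := le_one_sub_parB hC hα hα1
  have hbα : constC Ω * κ * α ≤ parB Ω α := by
    have := le_parB hC hα hα1
    rw [hκ]; rwa [mul_one_div]
  have rh : (k : ℝ) + m ≤ n + l + 1 := by exact_mod_cast h
  have hαk : α * k ≤ k := mul_le_of_le_one_left (by positivity) hα1.le
  have hαk0 : 0 ≤ α * k := by positivity
  have hbk : constC Ω * κ * (α * k) ≤ parB Ω α * k := by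
    rw [← mul_assoc]; gcongr
  have hη3 : constC Ω * κ * κ * (α * k) ≤ constC Ω * κ * (α * k) := by gcongr
  constructor
  · have : 0 ≤ constC Ω * κ * κ * (α * k) := by positivity
    linarith
  -- From `n ≥ k - (l - m) - 1` and `2(l - m) ≤ αk ≤ k`.
  · have hn : (k : ℝ) / 2 - 1 ≤ n := by linarith
    have := mul_le_mul_of_nonneg_left hn hb
    linarith

/-- Bound on the products arising from the squares of the kernel differences. -/
theorem exists_product_le (hC : 0 < constC Ω) (A B : ℝ) (hA : 0 < A) (hB : 0 < B) :
    ∃ K c : ℝ, 0 < K ∧ 0 < c ∧ ∀ (α : ℝ) (m n k l : ℕ), 0 < α → α < 1 → m ≤ n → m ≤ l →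
      n + l ≤ k + m + 1 → k + m ≤ n + l + 1 → ∀ d s f g d' e e' u u' : ℝ,
      1 ≤ u → 1 ≤ u' → 0 ≤ e → 0 ≤ e' →
      (2 * ((l : ℝ) - m) ≤ α * k →
        ∀ η, η * (1 + α * k) ≤ 1 + parB Ω α * k → η * (1 + α * k) ≤ 1 + parB Ω α * n →
          η * (1 + α * k) ≤ u ∧ η * (1 + α * k) ≤ u') →
      e * e' = Real.exp (-(totalRate Ω α m n k l) / 4) →
      |d| ≤ A / u * e → |s| ≤ 1 + ((l : ℝ) - m) → |f| ≤ A / Real.sqrt u' * e' →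
      |g| ≤ B * (1 + α * k) → |d'| ≤ A / u' * e' →
      |d * (s * f + g * d')| ≤ K * decay Ω c α k ((n : ℝ) - m) ((l : ℝ) - m) ^ 2 := by
  obtain ⟨K, c, hK, hc, H⟩ := exists_le_decay_sq hC
  obtain ⟨η, hη, hη1, Hη⟩ := exists_mul_le_variance hC
  -- In the application `u`, `u'` are `1 + bk` and `1 + bn` in either order. Both exceed `η(1+αk)`
  -- in the central regime; outside it only `u, u' ≥ 1` is used and `1 + αk` is bounded by `2(1+p)`.
  refine ⟨A ^ 2 * (1 + 2 * B) / η ^ 2 * K, c, by positivity, hc, ?_⟩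
  intro α m n k l hα hα1 hmn hml h1 h2 d s f g d' e e' u u' hu hu' he he' hcomp hee hd hs hf hg hd'
  have hx := H α m n k l hα hα1 hmn hml h1 h2
    (|d * (s * f + g * d')| / (A ^ 2 * (1 + 2 * B) / η ^ 2))
  have rml : (m : ℝ) ≤ l := by exact_mod_cast hml
  obtain ⟨p, hp⟩ : ∃ p : ℝ, p = l - m := ⟨_, rfl⟩
  have hp0 : 0 ≤ p := by linarith
  have hHη := Hη α m n k l hα hα1 h2
  rw [← hp] at hHη hcomp hs hx ⊢
  rw [← hee] at hx
  have hαk0 : 0 ≤ α * k := by positivity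
  set U := 1 + α * k with hU
  have hU1 : 1 ≤ U := by linarith
  have hs' : 1 ≤ Real.sqrt u' := Real.one_le_sqrt.2 hu'
  have hbase : |d * (s * f + g * d')| ≤
      A ^ 2 * (1 / u * ((1 + p) / Real.sqrt u' + B * U / u')) * (e * e') := by
    rw [abs_mul]
    have h3 : |s * f + g * d'| ≤ (1 + p) * (A / Real.sqrt u' * e') + B * U * (A / u' * e') := by
      refine (abs_add_le _ _).trans ?_
      rw [abs_mul, abs_mul]
      gcongr
    calc _ ≤ (A / u * e) * ((1 + p) * (A / Real.sqrt u' * e') + B * U * (A / u' * e')) := by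
          gcongr
      _ = _ := by ring
  have hη2 : η ^ 2 ≤ 1 := pow_le_one₀ hη.le hη1
  have hfin := hx ?_ ?_
  · rw [div_le_iff₀ (by positivity)] at hfin
    linarith
  · intro hcase
    rw [div_le_iff₀ (by positivity)]
    refine hbase.trans ?_
    have h3 : 1 / u * ((1 + p) / Real.sqrt u' + B * U / u') ≤ 1 * ((1 + p) / 1 + B * U / 1) := by
      gcongr
      rw [div_le_one (by linarith)]; exact hu
    have h4 : 1 * ((1 + p) / 1 + B * U / 1) ≤ (1 + p) * (1 + 2 * B) := by
      have : B * U ≤ B * (2 * (1 + p)) := by gcongr; linarith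
      linarith
    have h5 : (1 + p) * (1 + 2 * B) ≤ (1 + p) * (1 + 2 * B) / η ^ 2 := by
      rw [le_div_iff₀ (by positivity)]
      exact mul_le_of_le_one_right (by positivity) hη2
    have h6 := (h3.trans h4).trans h5
    calc _ ≤ A ^ 2 * ((1 + p) * (1 + 2 * B) / η ^ 2) * (e * e') := by gcongr
      _ = _ := by ring
  · intro hcase
    rw [div_le_iff₀ (by positivity)]
    refine hbase.trans ?_
    obtain ⟨hη3, hη4⟩ := hHη hcase
    obtain ⟨hc1, hc2⟩ := hcomp hcase η hη3 hη4
    have hsq : η * Real.sqrt U ≤ Real.sqrt u' := by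
      apply Real.le_sqrt_of_sq_le
      rw [mul_pow, Real.sq_sqrt (by linarith)]
      refine le_trans ?_ hc2
      gcongr
      nlinarith
    have hsU : 0 < Real.sqrt U := Real.sqrt_pos.2 (by linarith)
    have h3 : 1 / u * ((1 + p) / Real.sqrt u' + B * U / u') ≤
        1 / (η * U) * ((1 + p) / (η * Real.sqrt U) + B * U / (η * U)) := by gcongr
    have h4 : 1 / (η * U) * ((1 + p) / (η * Real.sqrt U) + B * U / (η * U)) =
        1 / U * ((1 + p) / Real.sqrt U + B) / η ^ 2 := by field_simp
    have h5 : (1 + p) / Real.sqrt U + B ≤ (1 + (1 + p) / Real.sqrt U) * (1 + 2 * B) := by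
      have : 0 ≤ (1 + p) / Real.sqrt U := by positivity
      nlinarith [mul_nonneg hB.le this]
    rw [h4] at h3
    calc _ ≤ A ^ 2 * (1 / U * ((1 + p) / Real.sqrt U + B) / η ^ 2) * (e * e') := by gcongr
      _ ≤ A ^ 2 * (1 / U * ((1 + (1 + p) / Real.sqrt U) * (1 + 2 * B)) / η ^ 2) * (e * e') := by
          gcongr
      _ = _ := by ring

/-! ### Pointwise bounds for the kernel and its differences. -/

theorem exists_kernelΓ_le (hΩ : 0 < Ω) (hΩ1 : Ω ≠ 1) :
    ∃ K c : ℝ, 0 < K ∧ 0 < c ∧ ∀ (α : ℝ) (m n k l : ℕ), 0 < α → α < 1 → m ≤ n → m ≤ l →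
      |kernelΓ Ω Ω α m n k l| ≤ K * decay Ω c α k ((n : ℝ) - m) ((l : ℝ) - m) := by
  have hC := constC_pos hΩ hΩ1
  obtain ⟨A, hA, HA⟩ := exists_kernelPoly_coeff_le hC
  obtain ⟨K, c, hK, hc, H⟩ := exists_le_decay_sq hC
  obtain ⟨η, hη, hη1, Hη⟩ := exists_mul_le_variance hC
  refine ⟨Real.sqrt (A ^ 2 / η * K), c, by positivity, hc, ?_⟩
  intro α m n k l hα hα1 hmn hml
  by_cases h : n + l = k + m
  swap
  · rw [kernelΓ, if_neg h, abs_zero]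
    exact mul_nonneg (Real.sqrt_nonneg _) decay_nonneg
  have hb := parB_nonneg (Ω := Ω) hC hα
  have rml : (m : ℝ) ≤ l := by exact_mod_cast hml
  have hp0 : 0 ≤ (l : ℝ) - m := by linarith
  have hV1 := le_varBound hC hα hα1 (N := k) (L := m) (k := k) (by omega) (by omega)
  have hV2 := le_varBound hC hα hα1 (N := n) (L := l) (k := k) (by omega) (by omega)
  have c1 := (HA α _ k m l k m l hα hα1 hV1 (by omega) (by omega) (by omega) (by omega) (by omega)
    (by omega)).1
  have c2 := (HA α _ n l m n l m hα hα1 hV2 (by omega) (by omega) (by omega) (by omega) (by omega)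
    (by omega)).1
  set e1 := Real.exp (-(tiltRate (varBound Ω α k) (dev Ω α k m l)) / 4) with he1
  set e2 := Real.exp (-(tiltRate (varBound Ω α k) (dev Ω α n l m)) / 4) with he2
  have hee : e1 * e2 = Real.exp (-(totalRate Ω α m n k l) / 4) := by
    rw [he1, he2, ← Real.exp_add, totalRate]; congr 1; ring
  have hu1 : 1 ≤ 1 + parB Ω α * k := by
    have : 0 ≤ parB Ω α * k := by positivity
    linarith
  have hu2 : 1 ≤ 1 + parB Ω α * n := by
    have : 0 ≤ parB Ω α * n := by positivity
    linarith
  have hs1 := Real.one_le_sqrt.2 hu1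
  have hs2 := Real.one_le_sqrt.2 hu2
  have hsq : kernelΓ Ω Ω α m n k l ^ 2 ≤
      A ^ 2 / (Real.sqrt (1 + parB Ω α * k) * Real.sqrt (1 + parB Ω α * n)) *
        Real.exp (-(totalRate Ω α m n k l) / 4) := by
    rw [kernelΓ_sq hΩ hΩ1 hα hα1 h, ← hee]
    refine (le_abs_self _).trans ?_
    rw [abs_mul]
    calc _ ≤ (A / Real.sqrt (1 + parB Ω α * k) * e1) * (A / Real.sqrt (1 + parB Ω α * n) * e2) := by
          gcongr
      _ = _ := by ring
  have hαk0 : 0 ≤ α * k := by positivity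
  have hx := H α m n k l hα hα1 hmn hml (by omega) (by omega)
    (kernelΓ Ω Ω α m n k l ^ 2 / (A ^ 2 / η)) ?_ ?_
  · rw [div_le_iff₀ (by positivity)] at hx
    refine abs_le_of_sq_le_sq ?_ (mul_nonneg (Real.sqrt_nonneg _) decay_nonneg)
    rw [mul_pow, Real.sq_sqrt (by positivity)]
    linarith
  · intro _
    rw [div_le_iff₀ (by positivity)]
    refine hsq.trans ?_
    have h3 : A ^ 2 / (Real.sqrt (1 + parB Ω α * k) * Real.sqrt (1 + parB Ω α * n)) ≤ A ^ 2 / η := by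
      gcongr
      nlinarith
    calc _ ≤ A ^ 2 / η * Real.exp (-(totalRate Ω α m n k l) / 4) := by gcongr
      _ ≤ A ^ 2 / η * ((1 + ((l : ℝ) - m)) * Real.exp (-(totalRate Ω α m n k l) / 4)) := by
          gcongr
          exact le_mul_of_one_le_left (Real.exp_pos _).le (by linarith)
      _ = _ := by ring
  · intro hcase
    obtain ⟨h4, h5⟩ := Hη α m n k l hα hα1 (by omega) hcase
    rw [div_le_iff₀ (by positivity)]
    refine hsq.trans ?_
    have h6 : η * (1 + α * k) ≤
        Real.sqrt (1 + parB Ω α * k) * Real.sqrt (1 + parB Ω α * n) := by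
      rw [← Real.sqrt_mul (by linarith)]
      apply Real.le_sqrt_of_sq_le
      rw [sq]
      exact mul_le_mul h4 h5 (by positivity) (by linarith)
    have h7 : (1 : ℝ) ≤ 1 + (1 + ((l : ℝ) - m)) / Real.sqrt (1 + α * k) := by
      have : 0 ≤ (1 + ((l : ℝ) - m)) / Real.sqrt (1 + α * k) := by positivity
      linarith
    calc _ ≤ A ^ 2 / (η * (1 + α * k)) * 1 * Real.exp (-(totalRate Ω α m n k l) / 4) := by
          rw [mul_one]; gcongr
      _ ≤ A ^ 2 / (η * (1 + α * k)) * (1 + (1 + ((l : ℝ) - m)) / Real.sqrt (1 + α * k)) *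
          Real.exp (-(totalRate Ω α m n k l) / 4) := by gcongr
      _ = _ := by field_simp

theorem diffOuter_eq_zero {m n k l : ℕ} (h : n + l ≠ k + m + 1) : diffOuter Ω α m n k l = 0 := by
  rw [diffOuter, kernelΓ, if_neg (by omega)]
  rcases l with _ | l
  · simp
  · rw [kernelΓ, if_neg (by omega)]; simp

theorem diffInner_eq_zero {m n k l : ℕ} (h : n + l + 1 ≠ k + m) : diffInner Ω α m n k l = 0 := by
  rw [diffInner, kernelΓ, if_neg (by omega)]
  rcases k with _ | k
  · simp
  · rw [kernelΓ, if_neg (by omega)]; simp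

/-- The last two differences are the first two at the mirrored indices `(l, k, n, m)`; by the
symmetry of the kernel they are the remaining pairs of terms in the commutators. The factor `√α` is
the root of the single `a` or `b` in front of each square. -/
theorem exists_diff_le (hΩ : 0 < Ω) (hΩ1 : Ω ≠ 1) :
    ∃ K c : ℝ, 0 < K ∧ 0 < c ∧ ∀ (α : ℝ) (m n k l : ℕ), 0 < α → α < 1 → m ≤ n → m ≤ l →
      |diffOuter Ω α m n k l| ≤
        K * Real.sqrt α * decay Ω c α k ((n : ℝ) - m) ((l : ℝ) - m) ∧
      |diffInner Ω α m n k l| ≤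
        K * Real.sqrt α * decay Ω c α k ((n : ℝ) - m) ((l : ℝ) - m) ∧
      |diffOuter Ω α l k n m| ≤
        K * Real.sqrt α * decay Ω c α k ((n : ℝ) - m) ((l : ℝ) - m) ∧
      |diffInner Ω α l k n m| ≤
        K * Real.sqrt α * decay Ω c α k ((n : ℝ) - m) ((l : ℝ) - m) := by
  have hC := constC_pos hΩ hΩ1
  obtain ⟨A, hA, HA⟩ := exists_kernelPoly_coeff_le hC
  obtain ⟨K, c, hK, hc, H⟩ := exists_product_le hC A (1 + constC Ω) hA (by positivity)
  refine ⟨Real.sqrt ((1 + constC Ω) * K), c, by positivity, hc, ?_⟩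
  intro α m n k l hα hα1 hmn hml
  have hd0 : 0 ≤ decay Ω c α k ((n : ℝ) - m) ((l : ℝ) - m) := decay_nonneg
  have hz : |(0 : ℝ)| ≤ Real.sqrt ((1 + constC Ω) * K) * Real.sqrt α *
      decay Ω c α k ((n : ℝ) - m) ((l : ℝ) - m) := by rw [abs_zero]; positivity
  have ha := parA_nonneg (Ω := Ω) hC hα
  have hb := parB_nonneg (Ω := Ω) hC hα
  have haα := parA_le (Ω := Ω) hC hα
  have hbα := parB_le (Ω := Ω) hC hα
  have hbα' : parB Ω α ≤ (1 + constC Ω) * α := by linarith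
  have rml : (m : ℝ) ≤ l := by exact_mod_cast hml

  have hroot : ∀ T q x : ℝ, 0 ≤ q → q ≤ (1 + constC Ω) * α →
      |x| ≤ K * decay Ω c α k ((n : ℝ) - m) ((l : ℝ) - m) ^ 2 → T ^ 2 = q * x →
      |T| ≤ Real.sqrt ((1 + constC Ω) * K) * Real.sqrt α *
        decay Ω c α k ((n : ℝ) - m) ((l : ℝ) - m) := by
    intro T q x hq0 hq hx hT
    refine abs_le_of_sq_le_sq ?_ (by positivity)
    rw [mul_pow, mul_pow, Real.sq_sqrt (by positivity), Real.sq_sqrt hα.le, hT]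
    calc q * x ≤ q * |x| := mul_le_mul_of_nonneg_left (le_abs_self x) hq0
      _ ≤ ((1 + constC Ω) * α) * (K * decay Ω c α k ((n : ℝ) - m) ((l : ℝ) - m) ^ 2) := by gcongr
      _ = _ := by ring
  -- A difference is nonzero only if `n + l` and `k + m` differ by exactly 1.
  by_cases hnear : n + l ≤ k + m + 1 ∧ k + m ≤ n + l + 1
  swap
  · rw [diffOuter_eq_zero (by omega), diffInner_eq_zero (by omega), diffOuter_eq_zero (by omega),
      diffInner_eq_zero (by omega)]
    exact ⟨hz, hz, hz, hz⟩
  obtain ⟨h1, h2⟩ := hnear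
  have hP := H α m n k l hα hα1 hmn hml h1 h2
  have hV1 := le_varBound hC hα hα1 (N := k) (L := m) (k := k) (by omega) (by omega)
  have hV2 := le_varBound hC hα hα1 (N := n) (L := l) (k := k) (by omega) (by omega)
  have c1 : ∀ N L j : ℕ, N ≤ k → k ≤ N + 1 → L ≤ m → m ≤ L + 1 → l ≤ j → j ≤ l + 1 → _ :=
    fun N L j => HA α _ N L j k m l hα hα1 hV1
  have c2 : ∀ N L j : ℕ, N ≤ n → n ≤ N + 1 → L ≤ l → l ≤ L + 1 → m ≤ j → j ≤ m + 1 → _ :=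
    fun N L j => HA α _ N L j n l m hα hα1 hV2
  have hee : Real.exp (-(tiltRate (varBound Ω α k) (dev Ω α k m l)) / 4) *
      Real.exp (-(tiltRate (varBound Ω α k) (dev Ω α n l m)) / 4) =
      Real.exp (-(totalRate Ω α m n k l) / 4) := by
    rw [← Real.exp_add, totalRate]; congr 1; ring
  set e1 := Real.exp (-(tiltRate (varBound Ω α k) (dev Ω α k m l)) / 4) with he1
  set e2 := Real.exp (-(tiltRate (varBound Ω α k) (dev Ω α n l m)) / 4) with he2
  have he10 : 0 ≤ e1 := (Real.exp_pos _).le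
  have he20 : 0 ≤ e2 := (Real.exp_pos _).le
  have hu1 : 1 ≤ 1 + parB Ω α * k := by
    have : 0 ≤ parB Ω α * k := by positivity
    linarith
  have hu2 : 1 ≤ 1 + parB Ω α * n := by
    have : 0 ≤ parB Ω α * n := by positivity
    linarith
  have hcount : ∀ N : ℕ, N ≤ k + 1 → ∀ q, 0 ≤ q → q ≤ (1 + constC Ω) * α →
      |(N : ℝ) * q| ≤ (1 + constC Ω) * (1 + α * k) := by
    intro N hN q hq0 hq
    have rN : (N : ℝ) ≤ k + 1 := by exact_mod_cast hN
    rw [abs_of_nonneg (by positivity)]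
    calc (N : ℝ) * q ≤ (k + 1) * ((1 + constC Ω) * α) := by gcongr
      _ = (1 + constC Ω) * (α + α * k) := by ring
      _ ≤ _ := by gcongr
  have hee' : e2 * e1 = Real.exp (-(totalRate Ω α m n k l) / 4) := by rw [mul_comm, hee]
  refine ⟨?_, ?_, ?_, ?_⟩
  · by_cases h : n + l = k + m + 1
    swap
    · rw [diffOuter_eq_zero h]; exact hz
    refine hroot _ (parA Ω α) _ ha haα (hP _ ((m : ℝ) + 1 - l) _ (l * parA Ω α) _ e1 e2 _ _ hu1 hu2
      he10 he20 (fun _ η x y => ⟨x, y⟩) hee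
      (c1 k m l (by omega) (by omega) (by omega) (by omega) (by omega) (by omega)).2
      (abs_le.2 ⟨by linarith, by linarith⟩)
      (c2 n l (m + 1) (by omega) (by omega) (by omega) (by omega) (by omega) (by omega)).1
      (hcount l (by omega) _ ha haα)
      (c2 n (l - 1) (m + 1) (by omega) (by omega) (by omega) (by omega) (by omega) (by omega)).2) ?_
    rw [diffOuter_sq hΩ hΩ1 hα hα1 h]; ring
  · by_cases h : n + l + 1 = k + m
    swap
    · rw [diffInner_eq_zero h]; exact hz
    refine hroot _ (parB Ω α) _ hb hbα' (hP _ ((l : ℝ) - m) _ (k * parB Ω α) _ e2 e1 _ _ hu2 hu1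
      he20 he10 (fun _ η x y => ⟨y, x⟩) hee'
      (c2 n l m (by omega) (by omega) (by omega) (by omega) (by omega) (by omega)).2
      (abs_le.2 ⟨by linarith, by linarith⟩)
      (c1 k m l (by omega) (by omega) (by omega) (by omega) (by omega) (by omega)).1
      (hcount k (by omega) _ hb hbα')
      (c1 (k - 1) m l (by omega) (by omega) (by omega) (by omega) (by omega) (by omega)).2) ?_
    rw [diffInner_sq hΩ hΩ1 hα hα1 h]; ring
  · by_cases h : k + m = n + l + 1
    swap
    · rw [diffOuter_eq_zero h]; exact hz
    refine hroot _ (parA Ω α) _ ha haα (hP _ ((l : ℝ) + 1 - m) _ (m * parA Ω α) _ e2 e1 _ _ hu2 hu1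
      he20 he10 (fun _ η x y => ⟨y, x⟩) hee'
      (c2 n l m (by omega) (by omega) (by omega) (by omega) (by omega) (by omega)).2
      (abs_le.2 ⟨by linarith, by linarith⟩)
      (c1 k m (l + 1) (by omega) (by omega) (by omega) (by omega) (by omega) (by omega)).1
      (hcount m (by omega) _ ha haα)
      (c1 k (m - 1) (l + 1) (by omega) (by omega) (by omega) (by omega) (by omega) (by omega)).2) ?_
    rw [diffOuter_sq hΩ hΩ1 hα hα1 h]; ring
  · by_cases h : k + m + 1 = n + l
    swap
    · rw [diffInner_eq_zero h]; exact hz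
    refine hroot _ (parB Ω α) _ hb hbα' (hP _ (-((l : ℝ) - m)) _ (n * parB Ω α) _ e1 e2 _ _ hu1 hu2
      he10 he20 (fun _ η x y => ⟨x, y⟩) hee
      (c1 k m l (by omega) (by omega) (by omega) (by omega) (by omega) (by omega)).2
      (abs_le.2 ⟨by linarith, by linarith⟩)
      (c2 n l m (by omega) (by omega) (by omega) (by omega) (by omega) (by omega)).1
      (hcount n (by omega) _ hb hbα')
      (c2 (n - 1) l m (by omega) (by omega) (by omega) (by omega) (by omega) (by omega)).2) ?_
    rw [diffInner_sq hΩ hΩ1 hα hα1 h]; ring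

/-! ### Integration over a slice. -/

/-- Within a slice `α` varies by the factor `M` at most, so the decay at `α` is controlled by that
at the lower end once the rate constant is divided by `M`. -/
theorem decay_le_decay {c c' s t k h p : ℝ} {M : ℝ} (hc : 0 < c) (hs : 0 < s)
    (hst : s ≤ t) (htM : t ≤ M * s) (hM : 1 < M) (hc' : 0 < c') (hcc : c' * M ≤ c) (hk : 0 ≤ k)
    (hp : 0 ≤ p) : decay Ω c t k h p ≤ decay Ω c' s k h p := by
  have hc'c : c' ≤ c := by nlinarith
  unfold decay
  have h1 : c' * p ^ 2 / (1 + k * s) ≤ c * p ^ 2 / (1 + k * t) := by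
    have ht : 0 < t := by linarith
    rw [div_le_div_iff₀ (by positivity) (by positivity)]
    have h3 : c' * (1 + k * t) ≤ c * (1 + k * s) := by
      have h4 : 1 + k * t ≤ M * (1 + k * s) := by nlinarith
      nlinarith [mul_le_mul_of_nonneg_left h4 hc'.le, mul_nonneg hk hs.le]
    nlinarith [mul_le_mul_of_nonneg_left h3 (sq_nonneg p)]
  have h2 : c' * s / (1 + k) * (h - k / (1 + constC Ω)) ^ 2 ≤
      c * t / (1 + k) * (h - k / (1 + constC Ω)) ^ 2 := by gcongr
  have h3 : c' * k * s ≤ c * k * t := by gcongr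
  have h4 : c' * p ≤ c * p := by gcongr
  have h5 : k * s ≤ k * t := by gcongr
  gcongr

theorem sqrt_sub_sqrt_le {x y : ℝ} (hx : 0 < x) (hy : 0 ≤ y) (hyx : y ≤ x) :
    Real.sqrt x - Real.sqrt y ≤ (x - y) / Real.sqrt x := by
  have hsx := Real.sqrt_pos.2 hx
  rw [le_div_iff₀ hsx]
  have h1 := Real.sqrt_le_sqrt hyx
  have h2 := Real.mul_self_sqrt hx.le
  have h3 := Real.mul_self_sqrt hy
  nlinarith [mul_le_mul_of_nonneg_right h1 (Real.sqrt_nonneg y)]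

/-- A density with an inverse square root singularity at `1`, integrated over a slice. -/
theorem slice_integral_bound {F : ℝ → ℂ} (hF : Measurable F) {s M G : ℝ} (hs : 0 < s) (hM : 1 < M)
    (hsM : M * s ≤ 1) (hG : 0 ≤ G)
    (hbd : ∀ x, s < x → x < M * s → ‖F x‖ ≤ G / Real.sqrt (1 - x)) :
    IntervalIntegrable F volume s (M * s) ∧
      ‖∫ x in s..(M * s), F x‖ ≤ G * (2 * (M - 1) / Real.sqrt (1 - 1 / M) * s) := by
  have hss : s ≤ M * s := by nlinarith
  have hg : IntervalIntegrable (fun x : ℝ => G * (1 - x) ^ (-(1 / 2) : ℝ)) volume s (M * s) := by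
    have := (intervalIntegral.intervalIntegrable_rpow' (a := 1 - s) (b := 1 - M * s)
      (show (-1 : ℝ) < -(1 / 2) by norm_num)).comp_sub_left 1
    simpa using this.const_mul G
  have hae : ∀ᵐ x ∂volume, x ∈ Set.Ioc s (M * s) → ‖F x‖ ≤ G * (1 - x) ^ (-(1 / 2) : ℝ) := by
    -- The upper end may be the singular point 1, as in the slice `i = 1`; it is a null set.
    have hne : ∀ᵐ x : ℝ ∂volume, x ≠ M * s := by simp [ae_iff]
    filter_upwards [hne] with x hx hx'
    have hlt : x < M * s := lt_of_le_of_ne hx'.2 hx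
    refine (hbd x hx'.1 hlt).trans (le_of_eq ?_)
    rw [Real.rpow_neg (by linarith), ← Real.sqrt_eq_rpow]; rfl
  refine ⟨?_, ?_⟩
  · refine hg.mono_fun hF.aestronglyMeasurable ?_
    rw [Set.uIoc_of_le hss, Filter.EventuallyLE, ae_restrict_iff' measurableSet_Ioc]
    filter_upwards [hae] with x hx hx'
    exact (hx hx').trans (Real.le_norm_self _)
  · refine (intervalIntegral.norm_integral_le_of_norm_le hss hae hg).trans ?_
    rw [intervalIntegral.integral_const_mul]
    refine mul_le_mul_of_nonneg_left ?_ hG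
    rw [intervalIntegral.integral_comp_sub_left (fun y : ℝ => y ^ (-(1 / 2) : ℝ)) 1,
      integral_rpow (Or.inl (by norm_num))]
    have e1 : (-(1 / 2) + 1 : ℝ) = 1 / 2 := by norm_num
    rw [e1, ← Real.sqrt_eq_rpow, ← Real.sqrt_eq_rpow]
    have hs1 : s ≤ 1 / M := by rw [le_div_iff₀ (by linarith)]; linarith
    have hM1 : 1 / M < 1 := by rw [div_lt_one (by linarith)]; exact hM
    have h1 := sqrt_sub_sqrt_le (x := 1 - s) (y := 1 - M * s) (by linarith) (by linarith)
      (by linarith)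
    have h2 : (1 - s - (1 - M * s)) / Real.sqrt (1 - s) ≤
        ((M - 1) * s) / Real.sqrt (1 - 1 / M) := by
      have : 0 < Real.sqrt (1 - 1 / M) := Real.sqrt_pos.2 (by linarith)
      have e : 1 - s - (1 - M * s) = (M - 1) * s := by ring
      rw [e]
      have : 0 ≤ (M - 1) * s := mul_nonneg (by linarith) hs.le
      gcongr
    have h3 : 2 * (M - 1) / Real.sqrt (1 - 1 / M) * s =
        2 * (((M - 1) * s) / Real.sqrt (1 - 1 / M)) := by ring
    rw [h3]; linarith

/-! ### Measurability in `α`. -/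

theorem measurable_kernelΓ (Ω B : ℝ) (m n k l : ℕ) :
    Measurable fun α => kernelΓ Ω B α m n k l := by
  unfold kernelΓ
  split_ifs
  · fun_prop
  · fun_prop

theorem measurable_spinFactor (γ0 γ1 : Matrix (Fin 2) (Fin 2) ℂ) (a b : Fin 2) :
    Measurable fun α => spinFactor γ0 γ1 α a b := by
  simp only [spinFactor, Matrix.sub_apply, Matrix.smul_apply, smul_eq_mul]
  fun_prop

theorem measurable_integrandMass (γ0 γ1 : Matrix (Fin 2) (Fin 2) ℂ) (Ω μ : ℝ) (m n k l : ℕ)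
    (a b : Fin 2) : Measurable fun α => integrandMass γ0 γ1 Ω μ α m n k l a b := by
  have h1 := measurable_kernelΓ Ω Ω m n k l
  have h2 := measurable_spinFactor γ0 γ1 a b
  simp only [integrandMass, Matrix.smul_apply, smul_eq_mul]
  fun_prop

theorem measurable_commX0 (Ω θ : ℝ) (m n k l : ℕ) :
    Measurable fun α => commX0 θ (kernelΓ Ω Ω α) m n k l := by
  have h := measurable_kernelΓ Ω Ω
  unfold commX0
  fun_prop

theorem measurable_commX1 (Ω θ : ℝ) (m n k l : ℕ) :
    Measurable fun α => commX1 θ (kernelΓ Ω Ω α) m n k l := by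
  have h := measurable_kernelΓ Ω Ω
  unfold commX1
  fun_prop

theorem measurable_integrandComm (γ0 γ1 : Matrix (Fin 2) (Fin 2) ℂ) (Ω θ : ℝ) (m n k l : ℕ)
    (a b : Fin 2) : Measurable fun α => integrandComm γ0 γ1 Ω θ α m n k l a b := by
  have h0 := measurable_commX0 Ω θ m n k l
  have h1 := measurable_commX1 Ω θ m n k l
  have h2 := measurable_spinFactor γ0 γ1
  simp only [integrandComm, Matrix.mul_apply, Fin.sum_univ_two, Matrix.add_apply,
    Matrix.smul_apply, smul_eq_mul, commSlashX, commSlashXTilde]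
  fun_prop

/-! ### Spin matrices and bounds on the integrands. -/

variable {γ0 γ1 : Matrix (Fin 2) (Fin 2) ℂ}

theorem IsDiracPair.mem_unitary_zero (h : IsDiracPair γ0 γ1) :
    γ0 ∈ Matrix.unitaryGroup (Fin 2) ℂ := by
  rw [Matrix.mem_unitaryGroup_iff, Matrix.star_eq_conjTranspose, h.skew_zero, mul_neg, h.sq_zero,
    neg_neg]

theorem IsDiracPair.mem_unitary_one (h : IsDiracPair γ0 γ1) :
    γ1 ∈ Matrix.unitaryGroup (Fin 2) ℂ := by
  rw [Matrix.mem_unitaryGroup_iff, Matrix.star_eq_conjTranspose, h.skew_one, mul_neg, h.sq_one,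
    neg_neg]

theorem norm_spinFactor_le (h : IsDiracPair γ0 γ1) (hα : 0 < α) (hα1 : α < 1) (a b : Fin 2) :
    ‖spinFactor γ0 γ1 α a b‖ ≤ 1 / Real.sqrt (1 - α) := by
  have hs : 0 < Real.sqrt (1 - α) := Real.sqrt_pos.2 (by linarith)
  have hU := mul_mem h.mem_unitary_zero h.mem_unitary_one
  have h1 := entry_norm_bound_of_unitary hU a b
  have h2 := entry_norm_bound_of_unitary (one_mem (Matrix.unitaryGroup (Fin 2) ℂ)) a b
  simp only [spinFactor, Matrix.sub_apply, Matrix.smul_apply, smul_eq_mul]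
  refine (norm_sub_le _ _).trans ?_
  rw [norm_mul, norm_mul, norm_mul, Complex.norm_I, one_mul, Complex.norm_real, Complex.norm_real,
    Real.norm_of_nonneg (div_nonneg (by linarith) (by positivity)),
    Real.norm_of_nonneg (by positivity)]
  have h3 : 0 ≤ (2 - α) / (2 * Real.sqrt (1 - α)) := div_nonneg (by linarith) (by positivity)
  calc _ ≤ (2 - α) / (2 * Real.sqrt (1 - α)) * 1 + α / (2 * Real.sqrt (1 - α)) * 1 := by
        gcongr
    _ = _ := by field_simp; ring

theorem norm_commX_le {θ : ℝ} (hθ : 0 < θ) (m n k l : ℕ) {T : ℝ}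
    (h1 : |diffOuter Ω α m n k l| ≤ T) (h2 : |diffInner Ω α m n k l| ≤ T)
    (h3 : |diffOuter Ω α l k n m| ≤ T) (h4 : |diffInner Ω α l k n m| ≤ T) :
    ‖commX0 θ (kernelΓ Ω Ω α) m n k l‖ ≤ 2 * Real.pi * θ * Real.sqrt (θ / 8) * (4 * T) ∧
    ‖commX1 θ (kernelΓ Ω Ω α) m n k l‖ ≤ 2 * Real.pi * θ * Real.sqrt (θ / 8) * (4 * T) := by
  have hpi := Real.pi_pos
  have e3 : diffOuter Ω α l k n m = Real.sqrt (l + 1) * kernelΓ Ω Ω α m n k (l + 1) -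
      Real.sqrt m * kernelΓ Ω Ω α (m - 1) n k l := by
    rw [diffOuter, kernelΓ_symm Ω Ω α m n k (l + 1), kernelΓ_symm Ω Ω α (m - 1) n k l]
  have e4 : diffInner Ω α l k n m = Real.sqrt (k + 1) * kernelΓ Ω Ω α m n (k + 1) l -
      Real.sqrt n * kernelΓ Ω Ω α m (n - 1) k l := by
    rw [diffInner, kernelΓ_symm Ω Ω α m n (k + 1) l, kernelΓ_symm Ω Ω α m (n - 1) k l]
  have hc : 0 ≤ 2 * Real.pi * θ * Real.sqrt (θ / 8) := by positivity
  rw [abs_le] at h1 h2 h3 h4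
  constructor
  · rw [commX0, norm_mul, Complex.norm_real, Complex.norm_real, Real.norm_of_nonneg hc]
    refine mul_le_mul_of_nonneg_left ?_ hc
    rw [Real.norm_eq_abs, abs_le]
    have e : Real.sqrt (m + 1) * kernelΓ Ω Ω α (m + 1) n k l
        - Real.sqrt l * kernelΓ Ω Ω α m n k (l - 1)
        + Real.sqrt m * kernelΓ Ω Ω α (m - 1) n k l
        - Real.sqrt (l + 1) * kernelΓ Ω Ω α m n k (l + 1)
        + Real.sqrt (n + 1) * kernelΓ Ω Ω α m (n + 1) k l
        - Real.sqrt k * kernelΓ Ω Ω α m n (k - 1) l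
        + Real.sqrt n * kernelΓ Ω Ω α m (n - 1) k l
        - Real.sqrt (k + 1) * kernelΓ Ω Ω α m n (k + 1) l =
        diffOuter Ω α m n k l - diffOuter Ω α l k n m + diffInner Ω α m n k l -
          diffInner Ω α l k n m := by
      rw [e3, e4, diffOuter, diffInner]; ring
    rw [e]
    constructor <;> linarith
  · rw [commX1, norm_mul, norm_mul, Complex.norm_I, one_mul, Complex.norm_real, Complex.norm_real,
      Real.norm_of_nonneg hc]
    refine mul_le_mul_of_nonneg_left ?_ hc
    rw [Real.norm_eq_abs, abs_le]
    have e : Real.sqrt (m + 1) * kernelΓ Ω Ω α (m + 1) n k l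
        - Real.sqrt l * kernelΓ Ω Ω α m n k (l - 1)
        - Real.sqrt m * kernelΓ Ω Ω α (m - 1) n k l
        + Real.sqrt (l + 1) * kernelΓ Ω Ω α m n k (l + 1)
        - Real.sqrt (n + 1) * kernelΓ Ω Ω α m (n + 1) k l
        + Real.sqrt k * kernelΓ Ω Ω α m n (k - 1) l
        + Real.sqrt n * kernelΓ Ω Ω α m (n - 1) k l
        - Real.sqrt (k + 1) * kernelΓ Ω Ω α m n (k + 1) l =
        diffOuter Ω α m n k l + diffOuter Ω α l k n m - diffInner Ω α m n k l -
          diffInner Ω α l k n m := by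
      rw [e3, e4, diffOuter, diffInner]; ring
    rw [e]
    constructor <;> linarith

theorem norm_integrandMass_le (h : IsDiracPair γ0 γ1) (hα : 0 < α) (hα1 : α < 1) (μ : ℝ)
    (m n k l : ℕ) (a b : Fin 2) {T : ℝ} (hT : |kernelΓ Ω Ω α m n k l| ≤ T) :
    ‖integrandMass γ0 γ1 Ω μ α m n k l a b‖ ≤ |μ| * T / Real.sqrt (1 - α) := by
  rw [integrandMass, Matrix.smul_apply, smul_eq_mul, norm_mul, norm_neg, Complex.norm_real,
    Real.norm_eq_abs, abs_mul]
  calc _ ≤ (|μ| * T) * (1 / Real.sqrt (1 - α)) := by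
        gcongr
        · exact mul_nonneg (abs_nonneg _) ((abs_nonneg _).trans hT)
        · exact norm_spinFactor_le h hα hα1 a b
    _ = _ := by ring

theorem norm_integrandComm_le (h : IsDiracPair γ0 γ1) (hΩ : 0 < Ω) (hα : 0 < α) (hα1 : α < 1)
    {θ : ℝ} (hθ : 0 < θ) (m n k l : ℕ) (a b : Fin 2) {T : ℝ}
    (h0 : ‖commX0 θ (kernelΓ Ω Ω α) m n k l‖ ≤ T) (h1 : ‖commX1 θ (kernelΓ Ω Ω α) m n k l‖ ≤ T) :
    ‖integrandComm γ0 γ1 Ω θ α m n k l a b‖ ≤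
      24 * Ω * T / (θ * α) / Real.sqrt (1 - α) := by
  have hT : 0 ≤ T := (norm_nonneg _).trans h0
  have hs : 0 < Real.sqrt (1 - α) := Real.sqrt_pos.2 (by linarith)
  have hg0 := entry_norm_bound_of_unitary h.mem_unitary_zero
  have hg1 := entry_norm_bound_of_unitary h.mem_unitary_one
  rw [integrandComm]
  set X0 := commX0 θ (kernelΓ Ω Ω α) m n k l with hX0
  set X1 := commX1 θ (kernelΓ Ω Ω α) m n k l with hX1
  set A := (Complex.I * ((2 * Ω / θ * ((2 - α) / α) : ℝ) : ℂ)) •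
      commSlashX γ0 γ1 θ (kernelΓ Ω Ω α) m n k l
    + (Ω : ℂ) • commSlashXTilde γ0 γ1 θ (kernelΓ Ω Ω α) m n k l with hA
  have hp0 : ∀ (x : ℂ) (i j : Fin 2), ‖x‖ ≤ T → ‖x * γ0 i j‖ ≤ T := fun x i j hx => by
    rw [norm_mul]; exact (mul_le_mul hx (hg0 i j) (norm_nonneg _) hT).trans (mul_one T).le
  have hp1 : ∀ (x : ℂ) (i j : Fin 2), ‖x‖ ≤ T → ‖x * γ1 i j‖ ≤ T := fun x i j hx => by
    rw [norm_mul]; exact (mul_le_mul hx (hg1 i j) (norm_nonneg _) hT).trans (mul_one T).le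
  -- The prefactors are at most `4Ω/(θα)` and `2Ω/(θα)`, each times `2T`; the two terms of the
  -- product with the spin factor then give 24.
  have hAij : ∀ i j, ‖A i j‖ ≤ 12 * Ω * T / (θ * α) := by
    intro i j
    have e : A i j = (Complex.I * ((2 * Ω / θ * ((2 - α) / α) : ℝ) : ℂ)) *
        (X0 * γ0 i j + X1 * γ1 i j) +
        ((Ω * (2 / θ) : ℝ) : ℂ) * (-(X1 * γ0 i j) + X0 * γ1 i j) := by
      rw [hA, commSlashX, commSlashXTilde, ← hX0, ← hX1]
      simp only [Matrix.add_apply, Matrix.smul_apply, smul_eq_mul]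
      push_cast; ring
    have hn1 : ‖X0 * γ0 i j + X1 * γ1 i j‖ ≤ T + T :=
      (norm_add_le _ _).trans (add_le_add (hp0 _ _ _ h0) (hp1 _ _ _ h1))
    have hn2 : ‖-(X1 * γ0 i j) + X0 * γ1 i j‖ ≤ T + T :=
      (norm_add_le _ _).trans (add_le_add ((norm_neg _).le.trans (hp0 _ _ _ h1)) (hp1 _ _ _ h0))
    have hc1 : ‖Complex.I * ((2 * Ω / θ * ((2 - α) / α) : ℝ) : ℂ)‖ ≤ 4 * Ω / (θ * α) := by
      have h2α : 0 ≤ 2 - α := by linarith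
      rw [norm_mul, Complex.norm_I, one_mul, Complex.norm_real, Real.norm_of_nonneg (by positivity)]
      calc 2 * Ω / θ * ((2 - α) / α) ≤ 2 * Ω / θ * (2 / α) := by gcongr; linarith
        _ = _ := by field_simp; norm_num
    have hc2 : ‖((Ω * (2 / θ) : ℝ) : ℂ)‖ ≤ 2 * Ω / (θ * α) := by
      rw [Complex.norm_real, Real.norm_of_nonneg (by positivity)]
      rw [mul_div_assoc', mul_comm Ω 2]
      apply div_le_div_of_nonneg_left (by positivity) (by positivity)
      exact mul_le_of_le_one_right hθ.le hα1.le
    rw [e]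
    exact (norm_add_le_of_le (norm_mul_le_of_le hc1 hn1) (norm_mul_le_of_le hc2 hn2)).trans
      (le_of_eq (by ring))
  have hS := norm_spinFactor_le h hα hα1
  rw [Matrix.mul_apply, Fin.sum_univ_two]
  refine (norm_add_le _ _).trans ?_
  rw [norm_mul, norm_mul]
  have hA0 : 0 ≤ 12 * Ω * T / (θ * α) := by positivity
  calc _ ≤ 12 * Ω * T / (θ * α) * (1 / Real.sqrt (1 - α)) +
        12 * Ω * T / (θ * α) * (1 / Real.sqrt (1 - α)) := by
        gcongr
        · exact hAij _ _
        · exact hS _ _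
        · exact hAij _ _
        · exact hS _ _
    _ = _ := by ring

theorem norm_slice_apply {θ M : ℝ} (hΩ : 0 < Ω) (i : ℕ) (F : ℝ → Matrix (Fin 2) (Fin 2) ℂ)
    (a b : Fin 2) : ‖slice Ω θ M i F a b‖ =
      2 * Ω / (θ ^ 2 * Real.pi ^ 2) * ‖∫ α in (M ^ (-(i : ℤ)))..(M ^ (-(i : ℤ) + 1)), F α a b‖ := by
  rw [slice, norm_mul, norm_neg, Complex.norm_real, Real.norm_of_nonneg (by positivity)]

end NCGrossNeveu

end

theorem mainTheorem3 (Ω : ℝ) (hΩ : 0 < Ω) (hΩ1 : Ω ≠ 1) (M : ℝ) (hM : 1 < M) :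
    ∃ K c : ℝ, 0 < K ∧ 0 < c ∧
      ∀ (γ0 γ1 : Matrix (Fin 2) (Fin 2) ℂ), NCGrossNeveu.IsDiracPair γ0 γ1 →
      ∀ (θ μ : ℝ), 0 < θ →
      ∀ (i m n k l : ℕ), 1 ≤ i → m ≤ n → m ≤ l →
      ∀ (a b : Fin 2),
        (IntervalIntegrable (fun α => NCGrossNeveu.integrandComm γ0 γ1 Ω θ α m n k l a b)
            MeasureTheory.volume (M ^ (-(i : ℤ))) (M ^ (-(i : ℤ) + 1)) ∧
          ‖NCGrossNeveu.sliceComm γ0 γ1 Ω θ M i m n k l a b‖ ≤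
            K * θ ^ (-(3 / 2 : ℝ)) * M ^ (-((i : ℝ) / 2)) *
              NCGrossNeveu.decay Ω c (M ^ (-(i : ℤ))) k ((n : ℝ) - (m : ℝ)) ((l : ℝ) - (m : ℝ))) ∧
        (IntervalIntegrable (fun α => NCGrossNeveu.integrandMass γ0 γ1 Ω μ α m n k l a b)
            MeasureTheory.volume (M ^ (-(i : ℤ))) (M ^ (-(i : ℤ) + 1)) ∧
          ‖NCGrossNeveu.sliceMass γ0 γ1 Ω θ μ M i m n k l a b‖ ≤
            K * (|μ| * θ ^ (-(2 : ℝ))) * M ^ (-(i : ℤ)) *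
              NCGrossNeveu.decay Ω c (M ^ (-(i : ℤ))) k ((n : ℝ) - (m : ℝ)) ((l : ℝ) - (m : ℝ))) := by
  obtain ⟨K1, c1, hK1, hc1, H1⟩ := NCGrossNeveu.exists_kernelΓ_le hΩ hΩ1
  obtain ⟨K2, c2, hK2, hc2, H2⟩ := NCGrossNeveu.exists_diff_le hΩ hΩ1
  have hpi := Real.pi_pos
  have hM0 : 0 < M := by linarith
  have hM1 : 1 / M < 1 := by rw [div_lt_one hM0]; exact hM
  set J := 2 * (M - 1) / Real.sqrt (1 - 1 / M) with hJ
  have hJ0 : 0 < J := by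
    have h1 : 0 < Real.sqrt (1 - 1 / M) := Real.sqrt_pos.2 (by linarith)
    have h2 : 0 < M - 1 := by linarith
    positivity
  set Kc := 2 * Ω / Real.pi ^ 2 * (24 * Ω * (2 * Real.pi / Real.sqrt 8 * (4 * K2)) * J) with hKc
  set Km := 2 * Ω / Real.pi ^ 2 * (K1 * J) with hKm
  have hKc0 : 0 < Kc := by positivity
  have hKm0 : 0 < Km := by positivity
  refine ⟨max Kc Km, min c1 c2 / M, by positivity, by positivity, ?_⟩
  intro γ0 γ1 hγ θ μ hθ i m n k l hi hmn hml a b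
  set c := min c1 c2 / M with hc
  have hc0 : 0 < c := by positivity
  have hcM : c * M = min c1 c2 := by rw [hc]; field_simp
  set s := M ^ (-(i : ℤ)) with hs
  have hs0 : 0 < s := by positivity
  have hMs : M ^ (-(i : ℤ) + 1) = M * s := by rw [zpow_add_one₀ hM0.ne', mul_comm]
  have hMs1 : M * s ≤ 1 := by
    rw [← hMs]; exact zpow_le_one_of_nonpos₀ hM.le (by omega)
  have hp0 : (0 : ℝ) ≤ (l : ℝ) - m := by
    have : (m : ℝ) ≤ l := by exact_mod_cast hml
    linarith
  have hk0 : (0 : ℝ) ≤ k := by positivity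
  set Δ := NCGrossNeveu.decay Ω c s k ((n : ℝ) - (m : ℝ)) ((l : ℝ) - (m : ℝ)) with hΔ
  have hΔ0 : 0 ≤ Δ := NCGrossNeveu.decay_nonneg
  have hd1 : ∀ α, s < α → α < M * s →
      NCGrossNeveu.decay Ω c1 α k ((n : ℝ) - (m : ℝ)) ((l : ℝ) - (m : ℝ)) ≤ Δ := fun α h1 h2 =>
    NCGrossNeveu.decay_le_decay hc1 hs0 h1.le h2.le hM hc0 (hcM.le.trans (min_le_left _ _)) hk0 hp0
  have hd2 : ∀ α, s < α → α < M * s →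
      NCGrossNeveu.decay Ω c2 α k ((n : ℝ) - (m : ℝ)) ((l : ℝ) - (m : ℝ)) ≤ Δ := fun α h1 h2 =>
    NCGrossNeveu.decay_le_decay hc2 hs0 h1.le h2.le hM hc0 (hcM.le.trans (min_le_right _ _)) hk0 hp0
  have hsq0 : 0 < Real.sqrt s := Real.sqrt_pos.2 hs0
  have hss : Real.sqrt s * Real.sqrt s = s := Real.mul_self_sqrt hs0.le
  rw [NCGrossNeveu.sliceComm, NCGrossNeveu.sliceMass, NCGrossNeveu.norm_slice_apply hΩ,
    NCGrossNeveu.norm_slice_apply hΩ, ← hs, hMs]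
  constructor
  · set P := 2 * Real.pi * θ * Real.sqrt (θ / 8) with hP
    have hP0 : 0 ≤ P := by positivity
    obtain ⟨hint, hbd⟩ := NCGrossNeveu.slice_integral_bound
      (NCGrossNeveu.measurable_integrandComm γ0 γ1 Ω θ m n k l a b) hs0 hM hMs1
      -- The factor `√α` of the differences against `1/α` leaves `1/√α ≤ 1/√s`; the slice length, of
      -- order `s`, turns it into `√s = M^(-i/2)`.
      (G := 24 * Ω * (P * (4 * (K2 * Δ))) / (θ * Real.sqrt s)) (by positivity) (by
        intro α h1 h2
        have hα : 0 < α := by linarith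
        have hα1 : α < 1 := by linarith
        have hT : K2 * Real.sqrt α *
            NCGrossNeveu.decay Ω c2 α k ((n : ℝ) - (m : ℝ)) ((l : ℝ) - (m : ℝ)) ≤
            K2 * Real.sqrt α * Δ := by
          have := hd2 α h1 h2
          gcongr
        obtain ⟨t1, t2, t3, t4⟩ := H2 α m n k l hα hα1 hmn hml
        obtain ⟨x0, x1⟩ := NCGrossNeveu.norm_commX_le hθ m n k l (t1.trans hT) (t2.trans hT)
          (t3.trans hT) (t4.trans hT)
        refine (NCGrossNeveu.norm_integrandComm_le hγ hΩ hα hα1 hθ m n k l a b x0 x1).trans ?_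
        have hsα : Real.sqrt s ≤ Real.sqrt α := Real.sqrt_le_sqrt h1.le
        have hαα : Real.sqrt α * Real.sqrt α = α := Real.mul_self_sqrt hα.le
        have hα0 : 0 < Real.sqrt α := Real.sqrt_pos.2 hα
        have e : 24 * Ω * (2 * Real.pi * θ * Real.sqrt (θ / 8) * (4 * (K2 * Real.sqrt α * Δ))) /
            (θ * α) = 24 * Ω * (P * (4 * (K2 * Δ))) / (θ * Real.sqrt α) := by
          rw [← hP]
          nth_rewrite 2 [← hαα]
          field_simp
        rw [e]
        gcongr)
    refine ⟨hint, ?_⟩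
    calc _ ≤ 2 * Ω / (θ ^ 2 * Real.pi ^ 2) *
          (24 * Ω * (P * (4 * (K2 * Δ))) / (θ * Real.sqrt s) * (J * s)) := by gcongr
      _ = Kc * θ ^ (-(3 / 2 : ℝ)) * M ^ (-((i : ℝ) / 2)) * Δ := by
          have e1 : θ ^ (-(3 / 2 : ℝ)) = Real.sqrt θ / θ ^ 2 := by
            rw [Real.sqrt_eq_rpow, ← Real.rpow_natCast, ← Real.rpow_sub hθ]; norm_num
          have e2 : M ^ (-((i : ℝ) / 2)) = Real.sqrt s := by
            rw [hs, Real.sqrt_eq_rpow, ← Real.rpow_intCast, ← Real.rpow_mul hM0.le]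
            congr 1; push_cast; ring
          have e3 : Real.sqrt (θ / 8) = Real.sqrt θ / Real.sqrt 8 := Real.sqrt_div hθ.le 8
          rw [e1, e2, hKc, hP, e3]
          have h8 : 0 < Real.sqrt 8 := Real.sqrt_pos.2 (by norm_num)
          nth_rewrite 2 [← hss]
          field_simp
      _ ≤ _ := by
          gcongr
          exact le_max_left _ _
  · obtain ⟨hint, hbd⟩ := NCGrossNeveu.slice_integral_bound
      (NCGrossNeveu.measurable_integrandMass γ0 γ1 Ω μ m n k l a b) hs0 hM hMs1
      (G := |μ| * (K1 * Δ)) (by positivity) (by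
        intro α h1 h2
        have hα : 0 < α := by linarith
        have hα1 : α < 1 := by linarith
        refine NCGrossNeveu.norm_integrandMass_le hγ hα hα1 μ m n k l a b ?_
        refine (H1 α m n k l hα hα1 hmn hml).trans ?_
        have := hd1 α h1 h2
        gcongr)
    refine ⟨hint, ?_⟩
    calc _ ≤ 2 * Ω / (θ ^ 2 * Real.pi ^ 2) * (|μ| * (K1 * Δ) * (J * s)) := by gcongr
      _ = Km * (|μ| * θ ^ (-(2 : ℝ))) * s * Δ := by
          have e1 : θ ^ (-(2 : ℝ)) = 1 / θ ^ 2 := by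
            rw [Real.rpow_neg hθ.le, one_div]; norm_cast
          rw [e1, hKm]
          field_simp
      _ ≤ _ := by
          gcongr
          exact le_max_right _ _
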